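/- Let $\mathcal G=(\mathcal V,\mathcal E)$ be a finite simple graph with $n=|\mathcal V|$ and let $d\ge 0$. For $p=(p_i)_{i\in\mathcal V}\in\mathbb R^{dn}$ let $F(p)=(\|p_j-p_i\|^2)_{ij\in\mathcal E}\in\mathbb R^{\mathcal E}$ and let $R(p)$ be the rigidity matrix, so that $\mathrm dF_p=2R(p)$. A configuration $p$ is regular if $\operatorname{rk}R(p)=\max_q\operatorname{rk}R(q)$. Let $\mathcal Q$ be the set of $m\in\mathrm{Im}\,F$ such that every $p\in F^{-1}(m)$ is regular, $\mathcal C=F^{-1}(\mathcal Q)$, $\mathcal S=\{(p,m)\in\mathcal C\times\mathcal Q:F(p)=m\}$, and $T_m\mathcal Q=\mathrm{Im}\,R(p)$ for $(p,m)\in\mathcal S$. Let $K$ be a field with an embedding into $\mathbb R$ (for example $K=\mathbb Q$). A property holds for generic $p$ (over $K$) if there is a nonzero polynomial $g$ with coefficients in $K$ such that it holds for all $p\in\mathbb R^{dn}$ with $g(p)\ne0$. The graph $\mathcal G$ is generically $d$-rigid if for generic $p$ (over $\mathbb Q$) every configuration $q$ sufficiently close to $p$ with $F(q)=F(p)$ is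 congruent to $p$. A controller defined by rational functions consists of an open subset $D$ of $\mathcal S$ and of matrices $\nu_{(p,m)}:\mathbb R^{\mathcal E}\to\mathbb R^{dn}$ and $\eta_{(p,m)}:\mathbb R^{\mathcal E}\to\mathbb R^{\mathcal E}$ whose entries are rational functions of $(p,m)$ with coefficients in $K$ and with denominators nowhere zero on $D$, such that $\eta_{(p,m)}x=2R(p)\nu_{(p,m)}x$ for all $(p,m)\in D$ and $x\in\mathbb R^{\mathcal E}$. For a target $(p^*,m^*)\in D$ it defines the system $$\dot p=\nu_{(p,m)}(m^*-m),\qquad \dot m=\eta_{(p,m)}(m^*-m).$$ It is locally exponentially stable for $(p^*,m^*)$ if there are a neighbourhood $U\subseteq D$ of $(p^*,m^*)$ in $\mathcal S$ and constants $C,c>0$ such that for every initial state in $U$ the solution exists in $D$ for all $t\ge0$ and satisfies $\|m^*-m(t)\|\le Ce^{-ct}$. Theorem. Let $\mathcal G$ be generically $d$-rigid. If a controller defined by rational functions with coefficients in $K$ is locally exponentially stable for some target $(p^*,m^*)\in D\subseteq\mathcal S$ (generic or not), then it is dynamically admissible: for generic $p$ (over $K$) with $(p,m)\in\mathcal S$,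 $m=F(p)$, the rational functions $\nu,\eta$ are defined at $(p,m)$, $\eta_{(p,m)}$ maps $T_m\mathcal Q$ to itself, and $\eta_{(p,m)}|_{T_m\mathcal Q}$ is hyperbolic (no complex eigenvalue has real part zero). As a consequence it is also algebraically admissible: for generic $p$ with $(p,m)\in\mathcal S$, $m = F(p)$, the functions are defined at $(p,m)$ and $\eta_{(p,m)}|_{T_m\mathcal Q}$ is an invertible map of $T_m\mathcal Q$ to itself. -/

import Mathlib

noncomputable section

namespace FormationControl

open Set Topology

variable {V : Type*} [Fintype V] [DecidableEq V]

/-- The configuration space `ℝ^{dn}` of `n = |V|` agents in `ℝ^d`, with its Euclidean norm. -/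
abbrev Config (V : Type*) [Fintype V] (d : ℕ) : Type _ := EuclideanSpace ℝ (V × Fin d)

/-- The edge space `ℝ^E`, with its Euclidean norm. -/
abbrev EdgeSpace (G : SimpleGraph V) [DecidableRel G.Adj] : Type _ :=
  EuclideanSpace ℝ G.edgeSet

/-- The position in `ℝ^d` of the agent `i`. -/
def position {d : ℕ} (p : Config V d) (i : V) : EuclideanSpace ℝ (Fin d) :=
  WithLp.toLp 2 fun a => p (i, a)

/-- The distance map `F`: its coordinate at the edge `ij` is `‖p_j - p_i‖ ^ 2`. -/
def distanceMap {d : ℕ} (G : SimpleGraph V) [DecidableRel G.Adj] (p : Config V d) :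
    EdgeSpace G :=
  WithLp.toLp 2 fun e =>
    Sym2.lift ⟨fun i j => ‖position p j - position p i‖ ^ 2,
      fun _ _ => congrArg (· ^ 2) (norm_sub_rev _ _)⟩ e.1

/-- The rigidity matrix `R(p)`: the row of the edge `ij` is `p_i - p_j` in the columns of `i`,
`p_j - p_i` in the columns of `j`, and zero elsewhere. One has `dF_p = 2 R(p)`. -/
def rigidityMatrix {d : ℕ} (G : SimpleGraph V) [DecidableRel G.Adj] (p : Config V d) :
    Matrix G.edgeSet (V × Fin d) ℝ :=
  fun e ka =>
    Sym2.lift ⟨fun i j =>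
        (if ka.1 = i then p (i, ka.2) - p (j, ka.2) else 0) +
          (if ka.1 = j then p (j, ka.2) - p (i, ka.2) else 0),
      fun _ _ => add_comm _ _⟩ e.1

/-- `P` holds for all generic configurations: it holds off the zero set of some nonzero
polynomial in the coordinates with coefficients in `K`. -/
def HoldsGenerically (K : Type*) [Field K] [Algebra K ℝ] {d : ℕ} (P : Config V d → Prop) :
    Prop :=
  ∃ g : MvPolynomial (V × Fin d) K, g ≠ 0 ∧
    ∀ p : Config V d, MvPolynomial.aeval (fun i => p i) g ≠ 0 → P p

/-- The framework `(G, p)` is locally rigid: every configuration near `p` with the same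
edge lengths is congruent to `p`. -/
def IsLocallyRigid {d : ℕ} (G : SimpleGraph V) [DecidableRel G.Adj] (p : Config V d) : Prop :=
  ∀ᶠ q in 𝓝 p, distanceMap G q = distanceMap G p → Congruent (position q) (position p)

/-- The graph `G` is generically `d`-rigid: its generic frameworks in `ℝ^d` are locally rigid. -/
def IsGenericallyRigid (d : ℕ) (G : SimpleGraph V) [DecidableRel G.Adj] : Prop :=
  HoldsGenerically ℚ fun p : Config V d => IsLocallyRigid G p

/-- A regular point of `F`: the rank of `dF_p = 2 R(p)` is the largest possible one. -/
def IsRegularPoint {d : ℕ} (G : SimpleGraph V) [DecidableRel G.Adj] (p : Config V d) : Prop :=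
  ∀ q : Config V d, (rigidityMatrix G q).rank ≤ (rigidityMatrix G p).rank

/-- The set `𝒬` of regular values of `F`: the points of the image of `F` all of whose
preimages are regular points. -/
def regularValues (d : ℕ) (G : SimpleGraph V) [DecidableRel G.Adj] : Set (EdgeSpace G) :=
  {m | (∃ p : Config V d, distanceMap G p = m) ∧
    ∀ p : Config V d, distanceMap G p = m → IsRegularPoint G p}

/-- The set `𝒞 = F⁻¹(𝒬)`. -/
def regularConfigs (d : ℕ) (G : SimpleGraph V) [DecidableRel G.Adj] : Set (Config V d) :=
  distanceMap G ⁻¹' regularValues d G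

/-- The state space `𝒮 = {(p, m) ∈ 𝒞 × 𝒬 : F(p) = m}`. -/
def stateSpace (d : ℕ) (G : SimpleGraph V) [DecidableRel G.Adj] :
    Set (Config V d × EdgeSpace G) :=
  {s | s.1 ∈ regularConfigs d G ∧ s.2 ∈ regularValues d G ∧ distanceMap G s.1 = s.2}

/-- The tangent space `T_m 𝒬 = Im R(p)` at `m = F(p)`, for `p ∈ 𝒞`. -/
def edgeTangent {d : ℕ} (G : SimpleGraph V) [DecidableRel G.Adj] (p : Config V d) :
    Submodule ℝ (EdgeSpace G) :=
  LinearMap.range (Matrix.toEuclideanLin (rigidityMatrix G p))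

/-- A rational function in the variables `σ` with coefficients in `K`, given as a quotient. -/
structure RationalExpr (σ K : Type*) [Field K] where
  num : MvPolynomial σ K
  den : MvPolynomial σ K

/-- The denominator does not vanish at `x`. -/
def RationalExpr.DefinedAt {σ K : Type*} [Field K] [Algebra K ℝ]
    (f : RationalExpr σ K) (x : σ → ℝ) : Prop :=
  MvPolynomial.aeval x f.den ≠ 0

/-- The value at `x` (meaningful where the denominator does not vanish). -/
def RationalExpr.eval {σ K : Type*} [Field K] [Algebra K ℝ]
    (f : RationalExpr σ K) (x : σ → ℝ) : ℝ :=
  MvPolynomial.aeval x f.num / MvPolynomial.aeval x f.den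

/-- The coordinates of a state `(p, m)`. -/
def stateCoords {d : ℕ} {G : SimpleGraph V} [DecidableRel G.Adj]
    (s : Config V d × EdgeSpace G) : (V × Fin d) ⊕ G.edgeSet → ℝ :=
  Sum.elim (fun i => s.1 i) (fun e => s.2 e)

/-- Matrices `ν` and `η` of rational functions of the state `(p, m)`. -/
structure RationalMatrices (K : Type*) [Field K] (d : ℕ)
    (G : SimpleGraph V) [DecidableRel G.Adj] where
  nuEntry : Matrix (V × Fin d) G.edgeSet (RationalExpr ((V × Fin d) ⊕ G.edgeSet) K)
  etaEntry : Matrix G.edgeSet G.edgeSet (RationalExpr ((V × Fin d) ⊕ G.edgeSet) K)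

section

variable {K : Type*} [Field K] [Algebra K ℝ] {d : ℕ} {G : SimpleGraph V} [DecidableRel G.Adj]

/-- All entries of `ν` and `η` are defined at the state `s`. -/
def RationalMatrices.DefinedAt (c : RationalMatrices K d G) (s : Config V d × EdgeSpace G) :
    Prop :=
  (∀ i e, (c.nuEntry i e).DefinedAt (stateCoords s)) ∧
    ∀ e e', (c.etaEntry e e').DefinedAt (stateCoords s)

/-- The linear map `ν_{(p,m)} : ℝ^E → ℝ^{dn}`. -/
def RationalMatrices.nu (c : RationalMatrices K d G) (s : Config V d × EdgeSpace G) :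
    EdgeSpace G →ₗ[ℝ] Config V d :=
  Matrix.toEuclideanLin (c.nuEntry.map fun f => f.eval (stateCoords s))

/-- The linear map `η_{(p,m)} : ℝ^E → ℝ^E`. -/
def RationalMatrices.eta (c : RationalMatrices K d G) (s : Config V d × EdgeSpace G) :
    EdgeSpace G →ₗ[ℝ] EdgeSpace G :=
  Matrix.toEuclideanLin (c.etaEntry.map fun f => f.eval (stateCoords s))

end

/-- A rationally defined edge-driven controller on a relatively open subset of `𝒮`: matrices of
rational functions defined there, such that `(ν x, η x)` is tangent to `𝒮`
(that is, `η x = 2 R(p) (ν x)`) for every state of this subset and every `x ∈ ℝ^E`. -/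
structure RationalController (K : Type*) [Field K] [Algebra K ℝ] (d : ℕ)
    (G : SimpleGraph V) [DecidableRel G.Adj] extends RationalMatrices K d G where
  domain : Set (Config V d × EdgeSpace G)
  domain_open : ∃ O : Set (Config V d × EdgeSpace G), IsOpen O ∧ domain = O ∩ stateSpace d G
  defined : ∀ s ∈ domain, toRationalMatrices.DefinedAt s
  tangent : ∀ s ∈ domain, ∀ x : EdgeSpace G,
    toRationalMatrices.eta s x =
      (2 : ℝ) • Matrix.toEuclideanLin (rigidityMatrix G s.1) (toRationalMatrices.nu s x)

section

variable {K : Type*} [Field K] [Algebra K ℝ] {d : ℕ} {G : SimpleGraph V} [DecidableRel G.Adj]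

/-- `t ↦ (p t, m t)`, `t ≥ 0`, is a solution in the domain of the controller of
`p' = ν_{(p,m)} (m* - m)`, `m' = η_{(p,m)} (m* - m)`. -/
structure RationalController.IsSolution (c : RationalController K d G) (mStar : EdgeSpace G)
    (p : ℝ → Config V d) (m : ℝ → EdgeSpace G) : Prop where
  mem_domain : ∀ t, 0 ≤ t → (p t, m t) ∈ c.domain
  node : ∀ t, 0 ≤ t → HasDerivWithinAt p (c.nu (p t, m t) (mStar - m t)) (Ici 0) t
  edge : ∀ t, 0 ≤ t → HasDerivWithinAt m (c.eta (p t, m t) (mStar - m t)) (Ici 0) t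

/-- Local exponential stability at the target `(p*, m*)`, `m* = F(p*)`: for all initial states in
some neighbourhood `U` of the target in `𝒮`, the solution exists for all `t ≥ 0` and satisfies
`‖m* - m(t)‖ ≤ C e^{-ct}`, with constants `C, c > 0` that depend only on `U`. -/
def RationalController.IsLocallyExpStable (c : RationalController K d G) (pStar : Config V d) :
    Prop :=
  ∃ U : Set (Config V d × EdgeSpace G),
    U ⊆ c.domain ∧ (pStar, distanceMap G pStar) ∈ U ∧
    U ∈ 𝓝[stateSpace d G] (pStar, distanceMap G pStar) ∧
    ∃ C rate : ℝ, 0 < C ∧ 0 < rate ∧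
      ∀ s ∈ U, ∃ (p : ℝ → Config V d) (m : ℝ → EdgeSpace G),
        c.IsSolution (distanceMap G pStar) p m ∧ p 0 = s.1 ∧ m 0 = s.2 ∧
        ∀ t, 0 ≤ t → ‖distanceMap G pStar - m t‖ ≤ C * Real.exp (-rate * t)

/-- A real endomorphism is hyperbolic if no complex eigenvalue of it has real part zero. -/
def IsHyperbolic {W : Type*} [AddCommGroup W] [Module ℝ W] [Module.Finite ℝ W]
    (f : W →ₗ[ℝ] W) : Prop :=
  ∀ z : ℂ, Polynomial.aeval z f.charpoly = 0 → z.re ≠ 0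

/-- Dynamic admissibility: for generic targets `(p, m) ∈ 𝒮`, `m = F(p)`, the rational functions
are defined at `(p, m)`, and `η_{(p,m)}` maps `T_m 𝒬` to itself and is hyperbolic there. -/
def RationalMatrices.IsDynamicallyAdmissible (c : RationalMatrices K d G) : Prop :=
  HoldsGenerically K fun p : Config V d => (p, distanceMap G p) ∈ stateSpace d G →
    c.DefinedAt (p, distanceMap G p) ∧
    ∃ h : ∀ x ∈ edgeTangent G p, c.eta (p, distanceMap G p) x ∈ edgeTangent G p,
      IsHyperbolic ((c.eta (p, distanceMap G p)).restrict h)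

/-- Algebraic admissibility: for generic targets `(p, m) ∈ 𝒮`, `m = F(p)`, the rational functions
are defined at `(p, m)`, and `η_{(p,m)}` maps `T_m 𝒬` to itself and is invertible there. -/
def RationalMatrices.IsAlgebraicallyAdmissible (c : RationalMatrices K d G) : Prop :=
  HoldsGenerically K fun p : Config V d => (p, distanceMap G p) ∈ stateSpace d G →
    c.DefinedAt (p, distanceMap G p) ∧
    ∃ h : ∀ x ∈ edgeTangent G p, c.eta (p, distanceMap G p) x ∈ edgeTangent G p,
      Function.Bijective ((c.eta (p, distanceMap G p)).restrict h)

end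

end FormationControl

end

/-! With `y = m* - m` the edge dynamics is `y' = -η y`. Two facts give the theorem.

At a stable target every eigenvalue of `η` on the tangent space has positive real part
(`RationalController.IsLocallyExpStable.re_pos`). The equilibria are not isolated and `p` may drift,
so the argument goes through a quadratic form. Let `c` be the decay rate and `A` the value of `η` at
the target. For some `μ` in `(0, c)` a shifted Lyapunov equation is solvable, and an eigenvalue with
real part `≤ 0` makes its form positive at some tangent vector `v`. Along a solution that starts in
the direction `±v` and stays near the target, `exp (2μt)` times the form does not decrease, which
contradicts decay at the rate `c > μ`.

Positive real parts are not a Zariski open condition, but they imply one that is: no two eigenvalues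
of the restriction `M` add up to zero, that is, `X ↦ M X + X Mᵀ` is invertible. Its determinant,
written in a basis of columns of `R(p)` and with denominators cleared (`restrictedMatrix` has the
adjugate of the Gram matrix in place of its inverse), is a polynomial in `p` over `K`. Being nonzero
at one target, generic or not, it is a nonzero polynomial. Where it does not vanish, no eigenvalue
is imaginary, since `iβ` would come with `-iβ`. -/

namespace FormationControl

open Set Topology

/-! ### Linear algebra: the Lyapunov operator and imaginary eigenvalues. -/

section LinearAlgebra

open Matrix Kronecker

variable {n : Type*} [Fintype n] [DecidableEq n]

/-- The matrix of the Lyapunov operator `X ↦ M * X + X * Mᵀ`. -/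
def kroneckerSum {R : Type*} [CommRing R] (M : Matrix n n R) : Matrix (n × n) (n × n) R :=
  M ⊗ₖ (1 : Matrix n n R) + (1 : Matrix n n R) ⊗ₖ M

theorem kroneckerSum_mulVec_vec {R : Type*} [CommRing R] (M X : Matrix n n R) :
    kroneckerSum M *ᵥ vec X = vec (M * X + X * Mᵀ) := by
  rw [kroneckerSum, Matrix.add_mulVec, kronecker_mulVec_vec, kronecker_mulVec_vec]
  ext ⟨i, j⟩
  simp [vec, add_comm]

theorem det_kroneckerSum_eq_zero_iff {F : Type*} [Field F] (M : Matrix n n F) :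
    (kroneckerSum M).det = 0 ↔ ∃ X : Matrix n n F, X ≠ 0 ∧ M * X + X * Mᵀ = 0 := by
  rw [← Matrix.exists_mulVec_eq_zero_iff]
  constructor
  · rintro ⟨v, hv, h⟩
    refine ⟨Matrix.of fun i j => v (j, i), ?_, ?_⟩
    · rintro h0
      apply hv
      ext ⟨i, j⟩
      exact congrFun (congrFun h0 j) i
    · rw [← vec_eq_zero_iff, ← kroneckerSum_mulVec_vec]
      exact h
  · rintro ⟨X, hX, h⟩
    exact ⟨vec X, fun h0 => hX (vec_eq_zero_iff.1 h0), by rw [kroneckerSum_mulVec_vec, h, vec_zero]⟩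

theorem exists_real_pair_of_charpoly_root (M : Matrix n n ℝ) (z : ℂ)
    (hz : Polynomial.aeval z M.charpoly = 0) :
    ∃ x y : n → ℝ, (x ≠ 0 ∨ y ≠ 0) ∧
      M *ᵥ x = z.re • x - z.im • y ∧ M *ᵥ y = z.im • x + z.re • y := by
  have h1 : (Matrix.scalar n z - M.map Complex.ofRealHom).det = 0 := by
    rw [← Matrix.eval_charpoly, Matrix.charpoly_map, Polynomial.eval_map]
    exact hz
  obtain ⟨v, hv, h⟩ := Matrix.exists_mulVec_eq_zero_iff.2 h1
  rw [Matrix.sub_mulVec, sub_eq_zero] at h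
  have h2 : ∀ i, ∑ j, (M i j : ℂ) * v j = z * v i := by
    intro i
    have := congrFun h i
    simp only [Matrix.scalar_apply, Matrix.mulVec, dotProduct,
      Matrix.map_apply, Complex.ofRealHom_eq_coe] at this
    rw [← this]
    simp [Matrix.diagonal_apply]
  refine ⟨fun i => (v i).re, fun i => (v i).im, ?_, ?_, ?_⟩
  · by_contra hc
    push Not at hc
    exact hv (funext fun i => Complex.ext (congrFun hc.1 i) (congrFun hc.2 i))
  · ext i
    have := congrArg Complex.re (h2 i)
    simpa [Matrix.mulVec, dotProduct] using this
  · ext i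
    have := congrArg Complex.im (h2 i)
    simp [Matrix.mulVec, dotProduct] at this ⊢
    linarith

theorem LinearMap.exists_real_pair_of_charpoly_root {W : Type*} [AddCommGroup W] [Module ℝ W]
    [Module.Finite ℝ W] (f : W →ₗ[ℝ] W) (z : ℂ) (hz : Polynomial.aeval z f.charpoly = 0) :
    ∃ x y : W, (x ≠ 0 ∨ y ≠ 0) ∧ f x = z.re • x - z.im • y ∧ f y = z.im • x + z.re • y := by
  let b := Module.finBasis ℝ W
  rw [← LinearMap.charpoly_toMatrix f b] at hz
  obtain ⟨x, y, hxy, hx, hy⟩ := FormationControl.exists_real_pair_of_charpoly_root _ z hz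
  have key : ∀ u : Fin (Module.finrank ℝ W) → ℝ,
      f (b.equivFun.symm u) = b.equivFun.symm (LinearMap.toMatrix b b f *ᵥ u) := by
    intro u
    apply b.equivFun.injective
    rw [LinearEquiv.apply_symm_apply]
    have := LinearMap.toMatrix_mulVec_repr b b f (b.equivFun.symm u)
    ext i
    have h2 := congrFun this i
    simp only [Module.Basis.equivFun_apply]
    rw [← h2]
    congr 2
    exact b.equivFun.apply_symm_apply u
  refine ⟨b.equivFun.symm x, b.equivFun.symm y, ?_, ?_, ?_⟩
  · simpa only [ne_eq, LinearEquiv.map_eq_zero_iff] using hxy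
  · rw [key, hx, map_sub, map_smul, map_smul]
  · rw [key, hy, map_add, map_smul, map_smul]

/-- For `v = x + iy` with `M v = iβ v`, the real part `x xᵀ + y yᵀ` of `v v*` is in the kernel of
the Lyapunov operator. -/
theorem det_kroneckerSum_eq_zero_of_imaginary_pair (M : Matrix n n ℝ) (β : ℝ) (x y : n → ℝ)
    (hxy : x ≠ 0 ∨ y ≠ 0) (hx : M *ᵥ x = -(β • y)) (hy : M *ᵥ y = β • x) :
    (kroneckerSum M).det = 0 := by
  rw [det_kroneckerSum_eq_zero_iff]
  refine ⟨vecMulVec x x + vecMulVec y y, ?_, ?_⟩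
  · intro h
    have h1 : ∀ i, x i * x i + y i * y i = 0 := fun i => by
      simpa [vecMulVec_apply] using congrFun (congrFun h i) i
    rcases hxy with h0 | h0 <;> apply h0 <;> ext i <;> simp only [Pi.zero_apply] <;>
      nlinarith [h1 i, mul_self_nonneg (x i), mul_self_nonneg (y i)]
  · rw [mul_add, add_mul, mul_vecMulVec, mul_vecMulVec, vecMulVec_mul, vecMulVec_mul,
      vecMul_transpose, vecMul_transpose, hx, hy]
    ext i j
    simp [vecMulVec_apply]

theorem mul_aeval_eq_aeval_mul {R A : Type*} [CommRing R] [Ring A] [Algebra R A] {a b x : A}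
    (h : a * x = x * b) (q : Polynomial R) :
    Polynomial.aeval a q * x = x * Polynomial.aeval b q := by
  have hp : ∀ k : ℕ, a ^ k * x = x * b ^ k := fun k => by
    induction k with
    | zero => simp
    | succ k ih => rw [pow_succ, mul_assoc, h, ← mul_assoc, ih, mul_assoc, ← pow_succ]
  induction q using Polynomial.induction_on' with
  | add p q hp hq => rw [map_add, map_add, add_mul, mul_add, hp, hq]
  | monomial k r =>
    rw [Polynomial.aeval_monomial, Polynomial.aeval_monomial, mul_assoc, hp, ← mul_assoc,
      ← mul_assoc, Algebra.commutes]

/-- Sylvester's argument: a kernel element `X` intertwines `M` and `-Mᵀ`, so Cayley–Hamilton gives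
`X χ(-Mᵀ) = 0` with `X ≠ 0`, where `χ` is the characteristic polynomial of `M`. Hence some
eigenvalue `k` of `-Mᵀ` is a root of `χ`; both `k` and `-k` are then eigenvalues of `M`, and one of
them has real part `≤ 0`. -/
theorem exists_charpoly_root_of_det_kroneckerSum_eq_zero (M : Matrix n n ℝ)
    (h : (kroneckerSum M).det = 0) :
    ∃ z : ℂ, z.re ≤ 0 ∧ Polynomial.aeval z M.charpoly = 0 := by
  obtain ⟨X, hX, hMX⟩ := (det_kroneckerSum_eq_zero_iff M).1 h
  let φ := Complex.ofRealHom.mapMatrix (m := n)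
  have hφ : Function.Injective φ := Matrix.map_injective Complex.ofRealHom.injective
  have hXc : φ X ≠ 0 := fun h0 => hX (hφ (by rw [h0, map_zero]))
  have : Nonempty n := by
    by_contra hn
    rw [not_nonempty_iff] at hn
    exact hX (Subsingleton.elim _ _)
  have hcomm : φ M * φ X = φ X * (-(φ M)ᵀ) := by
    have := congrArg φ hMX
    rw [map_add, map_mul, map_mul, map_zero] at this
    rw [mul_neg, eq_neg_iff_add_eq_zero]
    exact this
  have h2 := mul_aeval_eq_aeval_mul hcomm (φ M).charpoly
  rw [Matrix.aeval_self_charpoly, zero_mul] at h2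
  have h3 : ¬ IsUnit (Polynomial.aeval (-(φ M)ᵀ) (φ M).charpoly) := by
    intro hu
    exact hXc ((hu.mul_left_eq_zero).1 h2.symm)
  have h4 : (0 : ℂ) ∈ spectrum ℂ (Polynomial.aeval (-(φ M)ᵀ) (φ M).charpoly) :=
    (spectrum.zero_mem_iff ℂ).2 h3
  rw [spectrum.map_polynomial_aeval_of_nonempty _ _
    (spectrum.nonempty_of_isAlgClosed_of_finiteDimensional ℂ _)] at h4
  obtain ⟨k, hk, hk0⟩ := h4
  have hroot : ∀ w : ℂ, (φ M).charpoly.eval w = 0 → Polynomial.aeval w M.charpoly = 0 := by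
    intro w hw
    rw [← hw]
    change _ = (M.map Complex.ofRealHom).charpoly.eval w
    rw [Matrix.charpoly_map, Polynomial.eval_map]
    rfl
  rw [← spectrum.neg_eq, Set.mem_neg] at hk
  rw [Matrix.mem_spectrum_iff_isRoot_charpoly, Matrix.charpoly_transpose] at hk
  rcases le_total k.re 0 with hre | hre
  · exact ⟨k, hre, hroot k hk0⟩
  · exact ⟨-k, by simpa using hre, hroot _ hk⟩

end LinearAlgebra

/-! ### Dynamics: Lyapunov forms, exponential decay and trapping. -/

section Dynamics

open Filter

variable {E : Type*} [NormedAddCommGroup E] [InnerProductSpace ℝ E]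

/-- The operator `P ↦ A† P + P A` has finite spectrum, so some `s = 2μ` in `(0, 2c)` avoids it and
`s P - A† P - P A = 1` is solvable. The form need not be definite. -/
theorem exists_quadratic_form_solving_lyapunov [FiniteDimensional ℝ E] (A : E →ₗ[ℝ] E) {c : ℝ}
    (hc : 0 < c) :
    ∃ μ, 0 < μ ∧ μ < c ∧ ∃ P : E →ₗ[ℝ] E,
      ∀ y, 2 * μ * inner ℝ (P y) y - inner ℝ (P y) (A y) - inner ℝ (P (A y)) y = ‖y‖ ^ 2 := by
  let Λ : Module.End ℝ (Module.End ℝ E) :=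
    LinearMap.mulLeft ℝ (LinearMap.adjoint A) + LinearMap.mulRight ℝ A
  have hfin : (spectrum ℝ Λ).Finite := Module.End.finite_spectrum Λ
  have hinf : (Ioo (0 : ℝ) (2 * c)).Infinite := Ioo_infinite (by positivity)
  obtain ⟨s, hs, hsΛ⟩ := (hinf.sdiff hfin).nonempty
  have hu : IsUnit (algebraMap ℝ (Module.End ℝ (Module.End ℝ E)) s - Λ) := by
    simpa [spectrum.mem_iff] using hsΛ
  obtain ⟨P, hP⟩ := ((Module.End.isUnit_iff _).1 hu).2 1
  refine ⟨s / 2, by linarith [hs.1], by linarith [hs.2], P, fun y => ?_⟩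
  have h1 : s • P y - (LinearMap.adjoint A (P y) + P (A y)) = y := by
    simpa [Λ, Module.algebraMap_end_apply] using LinearMap.congr_fun hP y
  have h2 : inner ℝ (s • P y - (LinearMap.adjoint A (P y) + P (A y))) y = ‖y‖ ^ 2 := by
    rw [h1, real_inner_self_eq_norm_sq]
  rw [inner_sub_left, inner_add_left, real_inner_smul_left, LinearMap.adjoint_inner_left] at h2
  linarith

/-- When the identities `hP` at `a` and `b` are added, the terms in `β` cancel and `2 (μ - α)` times
the sum of the two values of the form equals `‖a‖² + ‖b‖² > 0`. -/
theorem inner_pos_of_real_pair {A P : E →ₗ[ℝ] E} {μ α β : ℝ} {a b : E} (hμ : 0 < μ)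
    (hP : ∀ y, 2 * μ * inner ℝ (P y) y - inner ℝ (P y) (A y) - inner ℝ (P (A y)) y = ‖y‖ ^ 2)
    (hα : α ≤ 0) (hab : a ≠ 0 ∨ b ≠ 0) (ha : A a = α • a - β • b) (hb : A b = β • a + α • b) :
    0 < inner ℝ (P a) a ∨ 0 < inner ℝ (P b) b := by
  have h1 := hP a
  have h2 := hP b
  rw [ha] at h1
  rw [hb] at h2
  simp only [map_sub, map_add, map_smul, inner_sub_left, inner_sub_right, inner_add_left,
    inner_add_right, real_inner_smul_left, real_inner_smul_right] at h1 h2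
  have h3 : 2 * (μ - α) * (inner ℝ (P a) a + inner ℝ (P b) b) = ‖a‖ ^ 2 + ‖b‖ ^ 2 := by
    linear_combination h1 + h2
  have h4 : 0 < ‖a‖ ^ 2 + ‖b‖ ^ 2 := by
    rcases hab with h | h <;> have := norm_pos_iff.2 h <;> positivity
  rw [← h3] at h4
  have h5 := (pos_iff_pos_of_mul_pos h4).1 (by linarith)
  by_contra! hc
  linarith [hc.1, hc.2]

/-- Along a solution of a perturbed linear equation, the quadratic form grows more slowly than
`exp (-2 * μ * t)` decays, so that fast exponential decay forces it to be nonpositive. -/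
theorem inner_nonpos_of_exp_decay {A P : E →ₗ[ℝ] E} {μ c C κ N : ℝ} (hμc : μ < c)
    (hN : 0 ≤ N) (hPN : ∀ y, ‖P y‖ ≤ N * ‖y‖) (hκ : 2 * N * κ ≤ 1)
    (hP : ∀ y, 2 * μ * inner ℝ (P y) y - inner ℝ (P y) (A y) - inner ℝ (P (A y)) y = ‖y‖ ^ 2)
    {y e : ℝ → E} (hy : ∀ t, 0 ≤ t → HasDerivWithinAt y (-(A (y t)) + e t) (Ici 0) t)
    (he : ∀ t, 0 ≤ t → ‖e t‖ ≤ κ * ‖y t‖)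
    (hdecay : ∀ t, 0 ≤ t → ‖y t‖ ≤ C * Real.exp (-c * t)) :
    inner ℝ (P (y 0)) (y 0) ≤ 0 := by
  let Q : E →L[ℝ] E := P.mkContinuous N hPN
  let φ : ℝ → ℝ := fun t => Real.exp (2 * μ * t) * inner ℝ (P (y t)) (y t)
  have hderiv : ∀ t, 0 ≤ t → HasDerivWithinAt φ
      (Real.exp (2 * μ * t) * (‖y t‖ ^ 2 + (inner ℝ (P (y t)) (e t) + inner ℝ (P (e t)) (y t))))
      (Ici 0) t := by
    intro t ht
    have h1 : HasDerivWithinAt (fun t => P (y t)) (P (-(A (y t)) + e t)) (Ici 0) t :=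
      Q.hasFDerivAt.comp_hasDerivWithinAt t (hy t ht)
    have h2 := h1.inner ℝ (hy t ht)
    have h3 : HasDerivAt (fun t : ℝ => Real.exp (2 * μ * t))
        (Real.exp (2 * μ * t) * (2 * μ * 1)) t :=
      ((hasDerivAt_id t).const_mul (2 * μ)).exp
    refine (h3.hasDerivWithinAt.mul h2).congr_deriv ?_
    rw [← hP (y t)]
    simp only [map_add, map_neg, inner_add_left, inner_add_right, inner_neg_left, inner_neg_right]
    ring
  have hmono : MonotoneOn φ (Ici 0) := by
    refine monotoneOn_of_deriv_nonneg (convex_Ici 0)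
      (fun t ht => (hderiv t ht).continuousWithinAt) ?_ ?_
    · intro t ht
      rw [interior_Ici] at ht
      exact ((hderiv t (le_of_lt ht)).hasDerivAt
        (Ici_mem_nhds ht)).differentiableAt.differentiableWithinAt
    · intro t ht
      rw [interior_Ici] at ht
      have ht0 : 0 ≤ t := le_of_lt ht
      rw [((hderiv t ht0).hasDerivAt (Ici_mem_nhds ht)).deriv]
      -- The two perturbation terms add up to at least `-2Nκ ‖y‖²`, which `‖y‖²` absorbs.
      refine mul_nonneg (Real.exp_pos _).le ?_
      have e0 := norm_nonneg (e t)
      have y0 := norm_nonneg (y t)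
      have b1 := (abs_le.1 ((abs_real_inner_le_norm (P (y t)) (e t)).trans
        (mul_le_mul (hPN _) (he t ht0) e0 (by positivity)))).1
      have b2 := (abs_le.1 ((abs_real_inner_le_norm (P (e t)) (y t)).trans
        (mul_le_mul_of_nonneg_right ((hPN _).trans
          (mul_le_mul_of_nonneg_left (he t ht0) hN)) y0))).1
      nlinarith [mul_le_mul_of_nonneg_right hκ (sq_nonneg ‖y t‖)]
  have hbound : ∀ t, 0 ≤ t → inner ℝ (P (y 0)) (y 0) ≤
      N * C ^ 2 * Real.exp (-(2 * (c - μ) * t)) := by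
    intro t ht
    have h1 := hmono (self_mem_Ici) ht ht
    simp only [φ, mul_zero, Real.exp_zero, one_mul] at h1
    have h2 : inner ℝ (P (y t)) (y t) ≤ N * (C * Real.exp (-c * t)) ^ 2 := by
      calc inner ℝ (P (y t)) (y t) ≤ ‖P (y t)‖ * ‖y t‖ := real_inner_le_norm _ _
        _ ≤ N * ‖y t‖ * ‖y t‖ := mul_le_mul_of_nonneg_right (hPN _) (norm_nonneg _)
        _ = N * ‖y t‖ ^ 2 := by ring
        _ ≤ _ := mul_le_mul_of_nonneg_left
          (pow_le_pow_left₀ (norm_nonneg _) (hdecay t ht) 2) hN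
    refine h1.trans ((mul_le_mul_of_nonneg_left h2 (Real.exp_pos _).le).trans (le_of_eq ?_))
    rw [show -(2 * (c - μ) * t) = 2 * μ * t + (-c * t + -c * t) by ring, Real.exp_add, Real.exp_add]
    ring
  have hlim : Tendsto (fun t : ℝ => N * C ^ 2 * Real.exp (-(2 * (c - μ) * t))) atTop (𝓝 0) := by
    have h1 : Tendsto (fun t : ℝ => 2 * (c - μ) * t) atTop atTop :=
      tendsto_id.const_mul_atTop (by linarith)
    simpa using (Real.tendsto_exp_neg_atTop_nhds_zero.comp h1).const_mul (N * C ^ 2)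
  exact ge_of_tendsto hlim ((eventually_ge_atTop 0).mono hbound)

/-- A curve whose speed is controlled both by its norm and by a decaying exponential stays small
if it starts small enough. -/
theorem exists_trapping_radius {W : Type*} [NormedAddCommGroup W] [NormedSpace ℝ W]
    {δ c M N : ℝ} (hδ : 0 < δ) (hc : 0 < c) (hM : 0 ≤ M) (hN : 0 ≤ N) :
    ∃ ε > 0, ∀ u u' : ℝ → W, (∀ t, 0 ≤ t → HasDerivWithinAt u (u' t) (Ici 0) t) →
      ‖u 0‖ ≤ ε → (∀ t, 0 ≤ t → ‖u t‖ ≤ δ → ‖u' t‖ ≤ M * ‖u t‖) →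
      (∀ t, 0 ≤ t → ‖u t‖ ≤ δ → ‖u' t‖ ≤ N * Real.exp (-c * t)) →
      ∀ t, 0 ≤ t → ‖u t‖ ≤ δ := by
  -- After time `T` the exponential bound leaves a displacement of at most `δ / 2`, the integral of
  -- `(N + 1) exp (-ct)` over `[T, ∞)`. Before `T`, growth at rate `M + 1` from the radius `ε`
  -- reaches at most `δ / 2`. The added ones make the comparison of derivatives strict.
  obtain ⟨T, hT0, hT⟩ : ∃ T : ℝ, 0 ≤ T ∧ (N + 1) / c * Real.exp (-(c * T)) ≤ δ / 2 := by
    have h1 : Tendsto (fun t : ℝ => c * t) atTop atTop := tendsto_id.const_mul_atTop hc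
    have h2 : Tendsto (fun t : ℝ => (N + 1) / c * Real.exp (-(c * t))) atTop (𝓝 0) := by
      simpa using (Real.tendsto_exp_neg_atTop_nhds_zero.comp h1).const_mul ((N + 1) / c)
    exact ((eventually_ge_atTop 0).and (h2.eventually_le_const (by positivity))).exists
  refine ⟨δ / 2 * Real.exp (-((M + 1) * T)), by positivity, ?_⟩
  intro u u' hu h0 h1 h2
  have hcont : ContinuousOn u (Ici 0) := fun t ht => (hu t ht).continuousWithinAt
  have hright : ∀ t, 0 ≤ t → HasDerivWithinAt u (u' t) (Ici t) t := fun t ht =>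
    (hu t ht).mono (Ici_subset_Ici.2 ht)
  let β₁ : ℝ → ℝ := fun t => δ / 2 * Real.exp ((M + 1) * (t - T))
  have hβ₁ : ∀ t, HasDerivAt β₁ ((M + 1) * β₁ t) t := by
    intro t
    have := ((((hasDerivAt_id t).sub_const T).const_mul (M + 1)).exp).const_mul (δ / 2)
    refine this.congr_deriv ?_
    simp only [β₁, id]
    ring
  have hβ₁pos : ∀ t, 0 < β₁ t := fun t => by positivity
  have hβ₁le : ∀ t, t ≤ T → β₁ t ≤ δ / 2 := by
    intro t ht
    have : Real.exp ((M + 1) * (t - T)) ≤ 1 := Real.exp_le_one_iff.2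
      (mul_nonpos_of_nonneg_of_nonpos (by linarith) (by linarith))
    simp only [β₁]
    nlinarith
  have phase1 : ∀ t ∈ Icc 0 T, ‖u t‖ ≤ β₁ t := by
    refine image_norm_le_of_norm_deriv_right_lt_deriv_boundary
      (hcont.mono Icc_subset_Ici_self) (fun t ht => hright t ht.1) ?_ hβ₁ ?_
    · refine h0.trans (le_of_eq ?_)
      simp only [β₁]
      congr 2
      ring
    · intro t ht heq
      have := h1 t ht.1 (by rw [heq]; linarith [hβ₁le t ht.2.le])
      rw [heq] at this
      linarith [hβ₁pos t]
  let β₂ : ℝ → ℝ := fun t => δ / 2 + (N + 1) / c * (Real.exp (-(c * T)) - Real.exp (-(c * t)))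
  have hβ₂ : ∀ t, HasDerivAt β₂ ((N + 1) * Real.exp (-c * t)) t := by
    intro t
    have := (((((hasDerivAt_id t).const_mul c).neg.exp).const_sub
      (Real.exp (-(c * T)))).const_mul ((N + 1) / c)).const_add (δ / 2)
    refine this.congr_deriv ?_
    simp only [id, neg_mul]
    field_simp
    simp
  have hβ₂le : ∀ t, β₂ t ≤ δ := by
    intro t
    have : 0 ≤ (N + 1) / c * Real.exp (-(c * t)) := by positivity
    simp only [β₂]
    linarith
  intro t ht
  rcases le_total t T with htT | htT
  · linarith [phase1 t ⟨ht, htT⟩, hβ₁le t htT]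
  · refine le_trans ?_ (hβ₂le t)
    refine image_norm_le_of_norm_deriv_right_lt_deriv_boundary (a := T) (b := t)
      (hcont.mono (fun s hs => hT0.trans hs.1)) (fun s hs => hright s (hT0.trans hs.1)) ?_ hβ₂ ?_
      ⟨htT, le_rfl⟩
    · have := (phase1 T ⟨hT0, le_rfl⟩).trans (hβ₁le T le_rfl)
      simpa [β₂] using this
    · intro s hs heq
      have := h2 s (hT0.trans hs.1) (by rw [heq]; exact hβ₂le s)
      linarith [Real.exp_pos (-c * s)]

end Dynamics

/-! ### Frameworks: the distance map and the openness of the regular states. -/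

section Frameworks

open Filter

variable {V : Type*} [Fintype V] {d : ℕ}

theorem distanceMap_apply (G : SimpleGraph V) [DecidableRel G.Adj] (p : Config V d) {i j : V}
    (h : s(i, j) ∈ G.edgeSet) :
    distanceMap G p ⟨s(i, j), h⟩ = ∑ a, (p (j, a) - p (i, a)) ^ 2 := by
  simp [distanceMap, position, EuclideanSpace.norm_sq_eq]

theorem rigidityMatrix_mulVec_apply [DecidableEq V] (G : SimpleGraph V) [DecidableRel G.Adj] (p : Config V d)
    (w : V × Fin d → ℝ) {i j : V} (h : s(i, j) ∈ G.edgeSet) :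
    (rigidityMatrix G p).mulVec w ⟨s(i, j), h⟩ =
      ∑ a, (p (j, a) - p (i, a)) * (w (j, a) - w (i, a)) := by
  simp only [Matrix.mulVec, dotProduct, rigidityMatrix, Sym2.lift_mk, Fintype.sum_prod_type]
  rw [Finset.sum_comm]
  refine Finset.sum_congr rfl fun a _ => ?_
  simp only [add_mul, ite_mul, zero_mul, Finset.sum_add_distrib, Finset.sum_ite_eq',
    Finset.mem_univ, if_true]
  ring

/-- `F` is a quadratic form, so its second-order expansion is exact. -/
theorem distanceMap_add_smul [DecidableEq V] (G : SimpleGraph V) [DecidableRel G.Adj] (p w : Config V d) (ε : ℝ) :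
    distanceMap G (p + ε • w) = distanceMap G p +
      ε • ((2 : ℝ) • Matrix.toEuclideanLin (rigidityMatrix G p) w + ε • distanceMap G w) := by
  ext ⟨e, he⟩
  induction e using Sym2.ind with
  | h i j =>
    have h1 : Matrix.toEuclideanLin (rigidityMatrix G p) w ⟨s(i, j), he⟩ =
        ∑ a, (p (j, a) - p (i, a)) * (w (j, a) - w (i, a)) :=
      rigidityMatrix_mulVec_apply G p w he
    simp only [PiLp.add_apply, PiLp.smul_apply, smul_eq_mul, h1, distanceMap_apply]
    simp only [Finset.mul_sum, ← Finset.sum_add_distrib]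
    exact Finset.sum_congr rfl fun a _ => by ring

theorem continuous_distanceMap (G : SimpleGraph V) [DecidableRel G.Adj] :
    Continuous (distanceMap (d := d) G) := by
  refine (PiLp.continuous_toLp 2 _).comp (continuous_pi fun e => ?_)
  obtain ⟨e, he⟩ := e
  induction e using Sym2.ind with
  | h i j =>
    simp only [Sym2.lift_mk, position]
    simp_rw [EuclideanSpace.norm_sq_eq]
    simp only [PiLp.sub_apply]
    fun_prop

theorem continuous_rigidityMatrix [DecidableEq V] (G : SimpleGraph V) [DecidableRel G.Adj] :
    Continuous (rigidityMatrix (d := d) G) := by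
  refine continuous_pi fun e => continuous_pi fun k => ?_
  obtain ⟨e, he⟩ := e
  induction e using Sym2.ind with
  | h i j =>
    simp only [rigidityMatrix, Sym2.lift_mk]
    split_ifs <;> fun_prop

theorem finrank_edgeTangent [DecidableEq V] (G : SimpleGraph V) [DecidableRel G.Adj] (p : Config V d) :
    Module.finrank ℝ (edgeTangent G p) = (rigidityMatrix G p).rank :=
  (Matrix.rank_eq_finrank_range_toLin _ (PiLp.basisFun 2 ℝ _) (PiLp.basisFun 2 ℝ _)).symm

theorem isOpen_setOf_le_rank_rigidityMatrix [DecidableEq V] (G : SimpleGraph V) [DecidableRel G.Adj] (r : ℕ) :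
    IsOpen {p : Config V d | r ≤ (rigidityMatrix G p).rank} := by
  let Φ : Matrix G.edgeSet (V × Fin d) ℝ →ₗ[ℝ] (Config V d →L[ℝ] EdgeSpace G) :=
    (LinearMap.toContinuousLinearMap.toLinearMap).comp
      (Matrix.toEuclideanLin (𝕜 := ℝ) (m := G.edgeSet) (n := V × Fin d)).toLinearMap
  have hΦ : Continuous fun p : Config V d => Φ (rigidityMatrix G p) :=
    Φ.continuous_of_finiteDimensional.comp (continuous_rigidityMatrix G)
  convert! (isOpen_setOfPred_nat_le_rank (𝕜 := ℝ) (E := Config V d)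
    (F := EdgeSpace G) r).preimage hΦ using 1
  ext p
  change r ≤ (rigidityMatrix G p).rank ↔ (r : Cardinal) ≤ Module.rank ℝ (edgeTangent G p)
  rw [← finrank_edgeTangent, ← Module.finrank_eq_rank, Nat.cast_le]

/-- Translating every connected component so that a chosen vertex of it is at the origin. -/
noncomputable def normalizeComponents (G : SimpleGraph V) (q : Config V d) : Config V d :=
  WithLp.toLp 2 fun k => q k - q ((G.connectedComponentMk k.1).out, k.2)

theorem normalizeComponents_sub {G : SimpleGraph V} (q : Config V d) {i j : V} (h : G.Adj i j)
    (a : Fin d) : normalizeComponents G q (i, a) - normalizeComponents G q (j, a) =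
      q (i, a) - q (j, a) := by
  have : G.connectedComponentMk i = G.connectedComponentMk j :=
    SimpleGraph.ConnectedComponent.sound h.reachable
  simp [normalizeComponents, this]

theorem distanceMap_normalizeComponents (G : SimpleGraph V) [DecidableRel G.Adj] (q : Config V d) :
    distanceMap G (normalizeComponents G q) = distanceMap G q := by
  ext ⟨e, he⟩
  induction e using Sym2.ind with
  | h i j =>
    simp only [distanceMap_apply,
      normalizeComponents_sub q (SimpleGraph.mem_edgeSet G |>.1 he).symm]

theorem rigidityMatrix_normalizeComponents [DecidableEq V] (G : SimpleGraph V) [DecidableRel G.Adj]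
    (q : Config V d) : rigidityMatrix G (normalizeComponents G q) = rigidityMatrix G q := by
  ext ⟨e, he⟩ k
  induction e using Sym2.ind with
  | h i j =>
    have hij := SimpleGraph.mem_edgeSet G |>.1 he
    simp only [rigidityMatrix, Sym2.lift_mk, normalizeComponents_sub q hij,
      normalizeComponents_sub q hij.symm]

theorem abs_sub_le_of_walk {G : SimpleGraph V} {q : Config V d} {s : ℝ}
    (hs : ∀ i j, G.Adj i j → ∀ a, |q (i, a) - q (j, a)| ≤ s) {i j : V} (w : G.Walk i j)
    (a : Fin d) : |q (i, a) - q (j, a)| ≤ w.length * s := by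
  induction w with
  | nil => simp
  | cons h w ih =>
    rename_i u v x
    rw [SimpleGraph.Walk.length_cons]
    push_cast
    calc |q (u, a) - q (x, a)| ≤ |q (u, a) - q (v, a)| + |q (v, a) - q (x, a)| :=
          abs_sub_le _ _ _
      _ ≤ _ := by linarith [hs _ _ h a]

/-- `F` is proper up to translations of the components: a bound on the edge lengths bounds, along
shortest walks, the position of each vertex relative to the base vertex of its component. -/
theorem exists_compact_of_bounded_distances (G : SimpleGraph V) [DecidableRel G.Adj] (B : ℝ) :
    ∃ S : Set (Config V d), IsCompact S ∧
      ∀ q, ‖distanceMap G q‖ ≤ B → normalizeComponents G q ∈ S := by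
  let len : V → ℝ := fun i => G.dist i (G.connectedComponentMk i).out
  let S₀ : Set (V × Fin d → ℝ) :=
    Set.pi univ fun k => Icc (-(len k.1 * √B)) (len k.1 * √B)
  refine ⟨(EuclideanSpace.equiv (V × Fin d) ℝ).toHomeomorph ⁻¹' S₀,
    (Homeomorph.isCompact_preimage _).2 (isCompact_univ_pi fun _ => isCompact_Icc), ?_⟩
  intro q hq k _
  have hs : ∀ i j, G.Adj i j → ∀ a, |q (i, a) - q (j, a)| ≤ √B := by
    intro i j hij a
    refine Real.abs_le_sqrt (le_trans ?_ hq)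
    have he : s(j, i) ∈ G.edgeSet := (SimpleGraph.mem_edgeSet G).2 hij.symm
    calc (q (i, a) - q (j, a)) ^ 2 ≤ ∑ a, (q (i, a) - q (j, a)) ^ 2 :=
          Finset.single_le_sum (f := fun a => (q (i, a) - q (j, a)) ^ 2)
            (fun _ _ => sq_nonneg _) (Finset.mem_univ a)
      _ = distanceMap G q ⟨s(j, i), he⟩ := (distanceMap_apply G q he).symm
      _ ≤ ‖distanceMap G q ⟨s(j, i), he⟩‖ := le_abs_self _
      _ ≤ ‖distanceMap G q‖ := PiLp.norm_apply_le _ _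
  have hreach : G.Reachable k.1 (G.connectedComponentMk k.1).out :=
    SimpleGraph.ConnectedComponent.exact (Quot.out_eq (G.connectedComponentMk k.1)).symm
  obtain ⟨w, hw⟩ := hreach.exists_walk_length_eq_dist
  have := abs_sub_le_of_walk hs w k.2
  rw [hw] at this
  exact abs_le.1 this

/-- Regularity of the whole fibre is an open condition. The configurations of smaller rank in a
compact set of normalized configurations form a compact set by semicontinuity of the rank, so their
image is closed, and it misses `F(p₀)`. Thus every small perturbation of `p₀` is an admissible
initial configuration. -/
theorem eventually_mem_stateSpace [DecidableEq V] (G : SimpleGraph V) [DecidableRel G.Adj] {p₀ : Config V d}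
    (h : (p₀, distanceMap G p₀) ∈ stateSpace d G) :
    ∀ᶠ p in 𝓝 p₀, (p, distanceMap G p) ∈ stateSpace d G := by
  set m₀ := distanceMap G p₀ with hm₀
  have hreg : ∀ q, distanceMap G q = m₀ → IsRegularPoint G q := h.2.1.2
  obtain ⟨S, hS, hSmem⟩ := exists_compact_of_bounded_distances (d := d) G (‖m₀‖ + 1)
  let r := (rigidityMatrix G p₀).rank
  let N : Set (Config V d) := S ∩ {p | r ≤ (rigidityMatrix G p).rank}ᶜ
  have hN : IsCompact N :=
    hS.inter_right (isOpen_setOf_le_rank_rigidityMatrix G r).isClosed_compl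
  have hclosed : IsClosed (distanceMap G '' N) :=
    (hN.image (continuous_distanceMap G)).isClosed
  have hnot : m₀ ∉ distanceMap G '' N := by
    rintro ⟨q, hq, hqm⟩
    exact hq.2 (hreg q hqm p₀)
  have hcont : Tendsto (distanceMap G) (𝓝 p₀) (𝓝 m₀) := (continuous_distanceMap G).tendsto p₀
  have hnorm : ∀ᶠ m in 𝓝 m₀, ‖m‖ ≤ ‖m₀‖ + 1 :=
    (continuous_norm.tendsto m₀).eventually_le_const (by linarith)
  filter_upwards [hcont.eventually (hclosed.isOpen_compl.mem_nhds hnot), hcont.eventually hnorm]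
    with p hp hpn
  have hval : distanceMap G p ∈ regularValues d G := by
    refine ⟨⟨p, rfl⟩, fun q hq q' => (hreg p₀ rfl q').trans ?_⟩
    by_contra hlt
    refine hp ⟨normalizeComponents G q, ⟨hSmem q (hq ▸ hpn), ?_⟩, ?_⟩
    · change ¬ r ≤ _
      rwa [rigidityMatrix_normalizeComponents]
    · rw [distanceMap_normalizeComponents, hq]
  exact ⟨hval, hval, rfl⟩

end Frameworks

/-! ### Stability: the spectrum of `η` at a stable target. -/

section Stability

open Filter

theorem continuous_aeval {σ K : Type*} [Field K] [Algebra K ℝ] (q : MvPolynomial σ K) :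
    Continuous fun x : σ → ℝ => MvPolynomial.aeval x q := by
  have : (fun x : σ → ℝ => MvPolynomial.aeval x q) =
      fun x => MvPolynomial.eval x (MvPolynomial.map (algebraMap K ℝ) q) := by
    ext x
    rw [MvPolynomial.eval_map, MvPolynomial.aeval_def]
  rw [this]
  exact MvPolynomial.continuous_eval _

theorem RationalExpr.continuousAt_eval {σ K : Type*} [Field K] [Algebra K ℝ]
    {f : RationalExpr σ K} {x : σ → ℝ} (h : f.DefinedAt x) : ContinuousAt f.eval x :=
  (continuous_aeval f.num).continuousAt.div (continuous_aeval f.den).continuousAt h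

variable {V : Type*} [Fintype V] {d : ℕ}

theorem continuous_stateCoords {G : SimpleGraph V} [DecidableRel G.Adj] :
    Continuous (stateCoords : Config V d × EdgeSpace G → (V × Fin d) ⊕ G.edgeSet → ℝ) := by
  refine continuous_pi fun k => ?_
  cases k with
  | inl i => simp only [stateCoords, Sum.elim_inl]; fun_prop
  | inr e => simp only [stateCoords, Sum.elim_inr]; fun_prop

/-- Applying a matrix of rational functions is continuous where they are defined, uniformly on
bounded sets of vectors. -/
theorem eventually_norm_toEuclideanLin_eval_sub_le {X σ K a b : Type*} [Field K] [Algebra K ℝ]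
    [Fintype a] [Fintype b] [DecidableEq b] [TopologicalSpace X] {x : X → σ → ℝ} {x₀ : X}
    (M : Matrix a b (RationalExpr σ K))
    (hx : ContinuousAt x x₀) (hM : ∀ i j, (M i j).DefinedAt (x x₀)) {κ : ℝ} (hκ : 0 < κ) :
    ∀ᶠ y in 𝓝 x₀, ∀ v : EuclideanSpace ℝ b,
      ‖Matrix.toEuclideanLin (M.map fun f => f.eval (x y)) v -
        Matrix.toEuclideanLin (M.map fun f => f.eval (x x₀)) v‖ ≤ κ * ‖v‖ := by
  let Φ : Matrix a b ℝ →ₗ[ℝ] (EuclideanSpace ℝ b →L[ℝ] EuclideanSpace ℝ a) :=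
    (LinearMap.toContinuousLinearMap.toLinearMap).comp
      (Matrix.toEuclideanLin (𝕜 := ℝ) (m := a) (n := b)).toLinearMap
  have h1 : ContinuousAt (fun y => M.map fun f => f.eval (x y)) x₀ :=
    continuousAt_pi.2 fun i => continuousAt_pi.2 fun j =>
      (RationalExpr.continuousAt_eval (hM i j)).comp hx
  have h2 : ContinuousAt (fun y => Φ (M.map fun f => f.eval (x y))) x₀ :=
    Φ.continuous_of_finiteDimensional.continuousAt.comp h1
  filter_upwards [Metric.tendsto_nhds.1 h2 κ hκ] with y hy v
  rw [dist_eq_norm] at hy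
  exact ((Φ (M.map fun f => f.eval (x y)) - Φ (M.map fun f => f.eval (x x₀))).le_opNorm v).trans
    (mul_le_mul_of_nonneg_right hy.le (norm_nonneg v))

theorem differentiable_distanceMap (G : SimpleGraph V) [DecidableRel G.Adj] :
    Differentiable ℝ (distanceMap (d := d) G) := by
  rw [differentiable_euclidean]
  rintro ⟨e, he⟩
  induction e using Sym2.ind with
  | h i j =>
    simp only [distanceMap_apply]
    fun_prop

variable [DecidableEq V] {K : Type*} [Field K] [Algebra K ℝ] {G : SimpleGraph V}
  [DecidableRel G.Adj]

theorem RationalController.mem_stateSpace (c : RationalController K d G)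
    {s : Config V d × EdgeSpace G} (hs : s ∈ c.domain) : s ∈ stateSpace d G := by
  obtain ⟨O, -, hO⟩ := c.domain_open
  rw [hO] at hs
  exact hs.2

theorem RationalController.eventually_mem_domain (c : RationalController K d G) {p₀ : Config V d}
    (h : (p₀, distanceMap G p₀) ∈ c.domain) :
    ∀ᶠ p in 𝓝 p₀, (p, distanceMap G p) ∈ c.domain := by
  have hS := eventually_mem_stateSpace G (c.mem_stateSpace h)
  obtain ⟨O, hO, hD⟩ := c.domain_open
  rw [hD] at h ⊢
  have hc : ContinuousAt (fun p : Config V d => (p, distanceMap G p)) p₀ :=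
    (continuous_id.prodMk (continuous_distanceMap G)).continuousAt
  exact (hc.eventually (hO.mem_nhds h.1)).and hS

/-- At a locally exponentially stable target, every complex eigenvalue of `η` on the tangent space
has positive real part; the eigenvalues are given here by real invariant pairs. -/
theorem RationalController.IsLocallyExpStable.re_pos {c : RationalController K d G}
    {p₀ : Config V d} (h : c.IsLocallyExpStable p₀) {α β : ℝ} {a b : EdgeSpace G}
    (haT : a ∈ edgeTangent G p₀) (hbT : b ∈ edgeTangent G p₀) (hab : a ≠ 0 ∨ b ≠ 0)
    (ha : c.eta (p₀, distanceMap G p₀) a = α • a - β • b)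
    (hb : c.eta (p₀, distanceMap G p₀) b = β • a + α • b) : 0 < α := by
  by_contra! hα
  obtain ⟨U, hUD, hmem, hU, C, rate, hC, hrate, hsol⟩ := h
  have hdef := c.defined _ (hUD hmem)
  set m₀ := distanceMap G p₀ with hm₀
  set A := c.eta (p₀, m₀) with hA
  obtain ⟨μ, hμ, hμr, P, hP⟩ := exists_quadratic_form_solving_lyapunov A hrate
  obtain ⟨v, hvT, hv⟩ : ∃ v ∈ edgeTangent G p₀, 0 < inner ℝ (P v) v := by
    rcases inner_pos_of_real_pair hμ hP hα hab ha hb with h | h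
    exacts [⟨a, haT, h⟩, ⟨b, hbT, h⟩]
  obtain ⟨w₀, hw₀⟩ := hvT
  -- The factor one half compensates `dF = 2 R`.
  let w : Config V d := (2⁻¹ : ℝ) • w₀
  have hw : (2 : ℝ) • Matrix.toEuclideanLin (rigidityMatrix G p₀) w = v := by
    rw [map_smul, hw₀, smul_inv_smul₀ two_ne_zero]
  let N := ‖LinearMap.toContinuousLinearMap P‖
  have hN : 0 ≤ N := norm_nonneg _
  have hPN : ∀ y, ‖P y‖ ≤ N * ‖y‖ := fun y => (LinearMap.toContinuousLinearMap P).le_opNorm y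
  let κ := 1 / (2 * N + 1)
  have hκ : 0 < κ := by positivity
  have hNκ : 2 * N * κ ≤ 1 := by
    rw [mul_one_div, div_le_one (by positivity)]
    linarith
  have hstate : Continuous fun p : Config V d => (p, distanceMap G p) :=
    continuous_id.prodMk (continuous_distanceMap G)
  have hcoords : ContinuousAt (fun p : Config V d => stateCoords (p, distanceMap G p)) p₀ :=
    (continuous_stateCoords.comp hstate).continuousAt
  have hη := eventually_norm_toEuclideanLin_eval_sub_le c.etaEntry hcoords hdef.2 hκ
  have hν := eventually_norm_toEuclideanLin_eval_sub_le c.nuEntry hcoords hdef.1 one_pos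
  let B := ‖LinearMap.toContinuousLinearMap (c.nu (p₀, m₀))‖ + 1
  have hB : 0 ≤ B := by positivity
  obtain ⟨L, hL, hLip⟩ :=
    ((differentiable_distanceMap G p₀).hasFDerivAt.isBigO_sub).exists_nonneg
  obtain ⟨δ, hδ, hball⟩ := Metric.nhds_basis_closedBall.eventually_iff.1
    (hη.and (hν.and hLip.bound))
  have hνB : ∀ p, ‖p - p₀‖ ≤ δ → ∀ x, ‖c.nu (p, distanceMap G p) x‖ ≤ B * ‖x‖ := by
    intro p hp x
    have h1 := (hball (mem_closedBall_iff_norm.2 hp)).2.1 x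
    have h2 := (LinearMap.toContinuousLinearMap (c.nu (p₀, m₀))).le_opNorm x
    calc ‖c.nu (p, distanceMap G p) x‖
        = ‖(c.nu (p, distanceMap G p) x - c.nu (p₀, m₀) x) + c.nu (p₀, m₀) x‖ := by
          rw [sub_add_cancel]
      _ ≤ ‖c.nu (p, distanceMap G p) x - c.nu (p₀, m₀) x‖ + ‖c.nu (p₀, m₀) x‖ := norm_add_le _ _
      _ ≤ 1 * ‖x‖ + ‖LinearMap.toContinuousLinearMap (c.nu (p₀, m₀))‖ * ‖x‖ := add_le_add h1 h2
      _ = B * ‖x‖ := by ring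
  obtain ⟨ε, hε, htrap⟩ := exists_trapping_radius (W := Config V d) hδ hrate
    (mul_nonneg hB hL) (mul_nonneg hB hC.le)
  have hpath : Tendsto (fun τ : ℝ => p₀ + τ • w) (𝓝[>] 0) (𝓝 p₀) := by
    have : Continuous fun τ : ℝ => p₀ + τ • w := by fun_prop
    simpa using (this.tendsto 0).mono_left nhdsWithin_le_nhds
  have hUev : ∀ᶠ p in 𝓝 p₀, (p, distanceMap G p) ∈ U :=
    (tendsto_nhdsWithin_of_tendsto_nhds_of_eventually_within _ (hstate.tendsto p₀)
      (eventually_mem_stateSpace G (c.mem_stateSpace (hUD hmem)))).eventually hU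
  have hVev : ∀ᶠ τ : ℝ in 𝓝[>] 0, 0 < inner ℝ (P (v + τ • distanceMap G w))
      (v + τ • distanceMap G w) := by
    have hcont : Continuous fun τ : ℝ => inner ℝ (P (v + τ • distanceMap G w))
        (v + τ • distanceMap G w) := by
      have : Continuous P := P.continuous_of_finiteDimensional
      fun_prop
    refine ((hcont.tendsto 0).mono_left nhdsWithin_le_nhds).eventually_const_lt ?_
    simpa using hv
  have hεev : ∀ᶠ τ : ℝ in 𝓝[>] 0, ‖(p₀ + τ • w) - p₀‖ ≤ ε := by
    have := (tendsto_iff_norm_sub_tendsto_zero.1 hpath)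
    exact this.eventually_le_const hε
  -- The initial configuration is `p₀ + τ w`, with `τ > 0` so small that it lies in `U` and within
  -- the trapping radius and that the form is still positive on the exact chord `v + τ F(w)`.
  obtain ⟨τ, hτU, hτV, hτε, hτ⟩ :=
    ((hpath.eventually hUev).and (hVev.and (hεev.and self_mem_nhdsWithin))).exists
  obtain ⟨p, m, hpm, hp0, hm0, hdecay⟩ := hsol _ hτU
  have hFm : ∀ t, 0 ≤ t → m t = distanceMap G (p t) := fun t ht =>
    (c.mem_stateSpace (hpm.mem_domain t ht)).2.2.symm
  -- While `p` is `δ`-close to `p₀`, its speed is at most `B ‖m₀ - m‖`. This is bounded by a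
  -- multiple of `‖p - p₀‖`, since `F` is differentiable at `p₀`, and by a multiple of `exp (-rate *
  -- t)`, by stability; so trapping applies.
  have hclose : ∀ t, 0 ≤ t → ‖p t - p₀‖ ≤ δ := by
    have hspeed : ∀ t, 0 ≤ t → ‖p t - p₀‖ ≤ δ →
        ‖c.nu (p t, m t) (m₀ - m t)‖ ≤ B * ‖m₀ - m t‖ := fun t ht hle => by
      rw [hFm t ht]
      exact hνB _ hle _
    refine htrap (fun t => p t - p₀) (fun t => c.nu (p t, m t) (m₀ - m t))
      (fun t ht => (hpm.node t ht).sub_const p₀) ?_ ?_ ?_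
    · simp only [hp0]
      exact hτε
    · intro t ht hle
      rw [mul_assoc]
      refine (hspeed t ht hle).trans (mul_le_mul_of_nonneg_left ?_ hB)
      rw [norm_sub_rev, hFm t ht]
      exact (hball (mem_closedBall_iff_norm.2 hle)).2.2
    · intro t ht hle
      rw [mul_assoc]
      exact (hspeed t ht hle).trans (mul_le_mul_of_nonneg_left (hdecay t ht) hB)
  -- Closeness to `p₀` makes `η - A` smaller than `κ`, so the dynamics is a small perturbation of
  -- `y' = -A y`.
  have hfinal := inner_nonpos_of_exp_decay hμr hN hPN hNκ hP (y := fun t => m₀ - m t)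
    (e := fun t => A (m₀ - m t) - c.eta (p t, m t) (m₀ - m t)) (C := C)
    (fun t ht => ((hpm.edge t ht).const_sub m₀).congr_deriv (by abel))
    (fun t ht => by
      rw [norm_sub_rev, hFm t ht]
      exact (hball (mem_closedBall_iff_norm.2 (hclose t ht))).1 _) hdecay
  have hy0 : m₀ - m 0 = -(τ • (v + τ • distanceMap G w)) := by
    rw [hm0]
    simp only
    rw [distanceMap_add_smul, hw, hm₀]
    abel
  simp only [hy0, map_neg, map_smul, inner_neg_neg, real_inner_smul_left,
    real_inner_smul_right] at hfinal
  have : 0 < τ * (τ * inner ℝ (P (v + τ • distanceMap G w)) (v + τ • distanceMap G w)) :=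
    mul_pos hτ (mul_pos hτ hτV)
  linarith

end Stability

/-! ### Column bases of the tangent space and the restriction of `η` to it. -/

section ColumnBasis

open Matrix

variable {m n : Type*} {r : ℕ}

/-- If the columns of `R` with indices `J` form a basis of the range of `R`, and `H` maps this range
to itself, this is the matrix of `H` on the range in that basis, times the determinant of the Gram
matrix of the basis. -/
def restrictedMatrix [Fintype m] (R : Matrix m n ℝ) (J : Fin r → n) (H : Matrix m m ℝ) :
    Matrix (Fin r) (Fin r) ℝ :=
  ((R.submatrix id J)ᵀ * R.submatrix id J).adjugate * (R.submatrix id J)ᵀ * H * R.submatrix id J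

theorem exists_mulVec_eq_submatrix_mulVec [Fintype n] (R : Matrix m n ℝ) (J : Fin r → n)
    (x : Fin r → ℝ) : ∃ w, R *ᵥ w = R.submatrix id J *ᵥ x := by
  classical
  refine ⟨(1 : Matrix n n ℝ).submatrix id J *ᵥ x, ?_⟩
  rw [Matrix.mulVec_mulVec]
  congr 1
  ext i j
  simp [Matrix.mul_apply, Matrix.one_apply]

theorem exists_columns_det_gram_ne_zero [Fintype m] [Fintype n]
    (R : Matrix m n ℝ) :
    ∃ J : Fin R.rank → n, ((R.submatrix id J)ᵀ * R.submatrix id J).det ≠ 0 := by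
  have hr : Module.finrank ℝ (Submodule.span ℝ (Set.range R.col)) = R.rank :=
    R.rank_eq_finrank_span_cols.symm
  obtain ⟨f, hf, -, hli⟩ := Submodule.exists_fun_fin_finrank_span_eq ℝ (Set.range R.col)
  choose J hJ using hf
  rw [← hr]
  refine ⟨J, fun hdet => ?_⟩
  obtain ⟨x, hx, hGx⟩ := Matrix.exists_mulVec_eq_zero_iff.2 hdet
  have h1 : x ∈ LinearMap.ker ((R.submatrix id J)ᵀ * R.submatrix id J).mulVecLin := hGx
  rw [Matrix.ker_mulVecLin_transpose_mul_self] at h1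
  have hcol : (R.submatrix id J).col = f := by
    ext j i
    rw [← hJ j]
    rfl
  have hinj : Function.Injective (R.submatrix id J).mulVec :=
    Matrix.mulVec_injective_iff.2 (hcol ▸ hli)
  exact hx (hinj (h1.trans (Matrix.mulVec_zero _).symm))

theorem submatrix_mulVec_injective [Fintype m]
    {R : Matrix m n ℝ} {J : Fin r → n}
    (hG : ((R.submatrix id J)ᵀ * R.submatrix id J).det ≠ 0) :
    Function.Injective (R.submatrix id J).mulVec := by
  intro x y hxy
  by_contra hne
  refine hG (Matrix.exists_mulVec_eq_zero_iff.1 ⟨x - y, sub_ne_zero.2 hne, ?_⟩)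
  rw [← Matrix.mulVec_mulVec, Matrix.mulVec_sub]
  change _ *ᵥ ((R.submatrix id J).mulVec x - (R.submatrix id J).mulVec y) = 0
  rw [hxy, sub_self, Matrix.mulVec_zero]

/-- A nonzero Gram determinant makes the `r` chosen columns independent, and the rank bound makes
them span. -/
theorem exists_submatrix_mulVec_eq [Fintype m] [Fintype n]
    {R : Matrix m n ℝ} {J : Fin r → n} (hr : R.rank ≤ r)
    (hG : ((R.submatrix id J)ᵀ * R.submatrix id J).det ≠ 0) (w : n → ℝ) :
    ∃ x, R *ᵥ w = R.submatrix id J *ᵥ x := by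
  have hle : LinearMap.range (R.submatrix id J).mulVecLin ≤ LinearMap.range R.mulVecLin := by
    rintro _ ⟨x, rfl⟩
    exact exists_mulVec_eq_submatrix_mulVec R J x
  have heq := Submodule.eq_of_le_of_finrank_le hle (by
    rw [LinearMap.finrank_range_of_inj (f := (R.submatrix id J).mulVecLin)
      (submatrix_mulVec_injective hG), Module.finrank_fin_fun]
    exact hr)
  have : R *ᵥ w ∈ LinearMap.range (R.submatrix id J).mulVecLin := heq ▸ ⟨w, rfl⟩
  obtain ⟨x, hx⟩ := this
  exact ⟨x, hx.symm⟩

/-- Used at generic configurations to exclude imaginary eigenvalues. The scalar `s` stands for the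
cleared denominator; it and the Gram determinant only rescale `β`. -/
theorem det_kroneckerSum_restrictedMatrix_eq_zero [Fintype m] [Fintype n]
    {R : Matrix m n ℝ} {J : Fin r → n}
    {H : Matrix m m ℝ} {s β : ℝ} (hr : R.rank ≤ r)
    (hG : ((R.submatrix id J)ᵀ * R.submatrix id J).det ≠ 0) (v w : n → ℝ)
    (hvw : R *ᵥ v ≠ 0 ∨ R *ᵥ w ≠ 0) (hv : H *ᵥ (R *ᵥ v) = -(β • (R *ᵥ w)))
    (hw : H *ᵥ (R *ᵥ w) = β • (R *ᵥ v)) :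
    (kroneckerSum (restrictedMatrix R J (s • H))).det = 0 := by
  obtain ⟨x, hx⟩ := exists_submatrix_mulVec_eq hr hG v
  obtain ⟨y, hy⟩ := exists_submatrix_mulVec_eq hr hG w
  rw [hx, hy] at hv hw hvw
  set Q := R.submatrix id J
  have hcancel : ∀ u, (Qᵀ * Q).adjugate *ᵥ (Qᵀ *ᵥ (Q *ᵥ u)) = (Qᵀ * Q).det • u := fun u => by
    rw [Matrix.mulVec_mulVec, Matrix.mulVec_mulVec, Matrix.mul_assoc, Matrix.adjugate_mul, Matrix.smul_mulVec,
      Matrix.one_mulVec]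
  have key : ∀ u, restrictedMatrix R J (s • H) *ᵥ u =
      s • ((Qᵀ * Q).adjugate *ᵥ (Qᵀ *ᵥ (H *ᵥ (Q *ᵥ u)))) := fun u => by
    simp only [restrictedMatrix, Matrix.mul_assoc, ← Matrix.mulVec_mulVec, Matrix.smul_mulVec,
      Matrix.mulVec_smul, Q]
  refine det_kroneckerSum_eq_zero_of_imaginary_pair _ (s * β * (Qᵀ * Q).det) x y ?_ ?_ ?_
  · refine hvw.imp (fun h h0 => h ?_) (fun h h0 => h ?_) <;> rw [h0, Matrix.mulVec_zero]
  · rw [key, hv, Matrix.mulVec_neg, Matrix.mulVec_neg, Matrix.mulVec_smul, Matrix.mulVec_smul,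
      hcancel]
    module
  · rw [key, hw, Matrix.mulVec_smul, Matrix.mulVec_smul, hcancel]
    module

/-- Used at the stable target, where the resulting pair with `α ≤ 0` contradicts stability. The
restricted matrix is a nonzero multiple of the matrix `M` of `H` in the column basis, and such a
factor does not affect the kernel of the Lyapunov operator. -/
theorem exists_pair_of_det_kroneckerSum_restrictedMatrix_eq_zero [Fintype m] [Fintype n]
    {R : Matrix m n ℝ} {J : Fin r → n}
    {H : Matrix m m ℝ} {s : ℝ} (hr : R.rank ≤ r) (hs : s ≠ 0)
    (hG : ((R.submatrix id J)ᵀ * R.submatrix id J).det ≠ 0)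
    (hH : ∀ x, ∃ w, H *ᵥ x = R *ᵥ w)
    (hdet : (kroneckerSum (restrictedMatrix R J (s • H))).det = 0) :
    ∃ α β : ℝ, α ≤ 0 ∧ ∃ v w : n → ℝ, (R *ᵥ v ≠ 0 ∨ R *ᵥ w ≠ 0) ∧
      H *ᵥ (R *ᵥ v) = α • (R *ᵥ v) - β • (R *ᵥ w) ∧
      H *ᵥ (R *ᵥ w) = β • (R *ᵥ v) + α • (R *ᵥ w) := by
  have hcol : ∀ j : Fin r, ∃ u, H *ᵥ ((R.submatrix id J).col j) = R.submatrix id J *ᵥ u :=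
    fun j => by
      obtain ⟨w, hw⟩ := hH ((R.submatrix id J).col j)
      rw [hw]
      exact exists_submatrix_mulVec_eq hr hG w
  choose u hu using hcol
  let M : Matrix (Fin r) (Fin r) ℝ := Matrix.of fun i j => u j i
  have hHQ : H * R.submatrix id J = R.submatrix id J * M := by
    ext i j
    exact congrFun (hu j) i
  have hres : restrictedMatrix R J (s • H) =
      (s * ((R.submatrix id J)ᵀ * R.submatrix id J).det) • M := by
    rw [restrictedMatrix, Matrix.mul_smul, Matrix.smul_mul, Matrix.mul_assoc _ H, hHQ,
      Matrix.mul_assoc _ _ (R.submatrix id J * M), ← Matrix.mul_assoc _ _ M, ← Matrix.mul_assoc,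
      Matrix.adjugate_mul, Matrix.smul_mul, Matrix.one_mul, smul_smul]
  have hM : (kroneckerSum M).det = 0 := by
    rw [hres] at hdet
    obtain ⟨X, hX, hMX⟩ := (det_kroneckerSum_eq_zero_iff _).1 hdet
    refine (det_kroneckerSum_eq_zero_iff _).2 ⟨X, hX, ?_⟩
    rw [Matrix.smul_mul, Matrix.transpose_smul, Matrix.mul_smul, ← smul_add] at hMX
    exact (smul_eq_zero.1 hMX).resolve_left (mul_ne_zero hs hG)
  obtain ⟨z, hz, hroot⟩ := exists_charpoly_root_of_det_kroneckerSum_eq_zero M hM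
  obtain ⟨x, y, hxy, hx, hy⟩ := exists_real_pair_of_charpoly_root M z hroot
  obtain ⟨v, hv⟩ := exists_mulVec_eq_submatrix_mulVec R J x
  obtain ⟨w, hw⟩ := exists_mulVec_eq_submatrix_mulVec R J y
  refine ⟨z.re, z.im, hz, v, w, ?_, ?_, ?_⟩
  · rw [hv, hw]
    have h0 : ∀ u, R.submatrix id J *ᵥ u = 0 → u = 0 := fun u hu =>
      submatrix_mulVec_injective hG (hu.trans (Matrix.mulVec_zero _).symm)
    exact hxy.imp (fun h h1 => h (h0 _ h1)) (fun h h1 => h (h0 _ h1))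
  · rw [hv, hw, Matrix.mulVec_mulVec, hHQ, ← Matrix.mulVec_mulVec, hx, Matrix.mulVec_sub,
      Matrix.mulVec_smul, Matrix.mulVec_smul]
  · rw [hv, hw, Matrix.mulVec_mulVec, hHQ, ← Matrix.mulVec_mulVec, hy, Matrix.mulVec_add,
      Matrix.mulVec_smul, Matrix.mulVec_smul]

end ColumnBasis

/-! ### Polynomial functions of the configuration over `K`, and genericity. -/

section PolynomialFunctions

variable (V : Type*) [Fintype V] (d : ℕ) (K : Type*) [Field K] [Algebra K ℝ]

/-- The functions of the configuration given by polynomials with coefficients in `K`. -/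
noncomputable def polynomialFunctions : Subalgebra K (Config V d → ℝ) :=
  (MvPolynomial.aeval fun (i : V × Fin d) (p : Config V d) => p i).range

variable {V d K}

theorem aeval_coordinates_apply (q : MvPolynomial (V × Fin d) K) (p : Config V d) :
    MvPolynomial.aeval (fun (i : V × Fin d) (p : Config V d) => p i) q p =
      MvPolynomial.aeval (fun i => p i) q := by
  induction q using MvPolynomial.induction_on with
  | C a => simp
  | add f g hf hg => simp [hf, hg]
  | mul_X f i hf => simp [hf]

theorem mem_polynomialFunctions_iff {f : Config V d → ℝ} :
    f ∈ polynomialFunctions V d K ↔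
      ∃ q : MvPolynomial (V × Fin d) K, ∀ p, f p = MvPolynomial.aeval (fun i => p i) q := by
  constructor
  · rintro ⟨q, rfl⟩
    exact ⟨q, aeval_coordinates_apply q⟩
  · rintro ⟨q, hq⟩
    exact ⟨q, funext fun p => (aeval_coordinates_apply q p).trans (hq p).symm⟩

theorem coordinate_mem_polynomialFunctions (i : V × Fin d) :
    (fun p => p i) ∈ polynomialFunctions V d K :=
  mem_polynomialFunctions_iff.2 ⟨MvPolynomial.X i, fun p => by simp⟩

theorem aeval_mem_polynomialFunctions {σ : Type*} {x : Config V d → σ → ℝ}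
    (hx : ∀ i, (fun p => x p i) ∈ polynomialFunctions V d K) (q : MvPolynomial σ K) :
    (fun p => MvPolynomial.aeval (x p) q) ∈ polynomialFunctions V d K := by
  induction q using MvPolynomial.induction_on with
  | C a =>
    simp only [MvPolynomial.aeval_C]
    exact (polynomialFunctions V d K).algebraMap_mem a
  | add f g hf hg =>
    simp only [map_add]
    exact add_mem hf hg
  | mul_X f i hf =>
    simp only [map_mul, MvPolynomial.aeval_X]
    exact mul_mem hf (hx i)

theorem continuous_of_mem_polynomialFunctions {f : Config V d → ℝ}
    (hf : f ∈ polynomialFunctions V d K) : Continuous f := by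
  obtain ⟨q, hq⟩ := mem_polynomialFunctions_iff.1 hf
  rw [funext hq]
  exact (continuous_aeval q).comp (continuous_pi fun i => by fun_prop)

/-- A neighbourhood contains a product of infinite sets, on which only the zero polynomial vanishes.
-/
theorem eq_zero_of_eventually_eq_zero {f : Config V d → ℝ} (hf : f ∈ polynomialFunctions V d K)
    {p₀ : Config V d} (h : ∀ᶠ p in 𝓝 p₀, f p = 0) (p : Config V d) : f p = 0 := by
  obtain ⟨q, hq⟩ := mem_polynomialFunctions_iff.1 hf
  have haeval : ∀ x : V × Fin d → ℝ, MvPolynomial.aeval x q =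
      MvPolynomial.eval x (MvPolynomial.map (algebraMap K ℝ) q) := fun x => by
    rw [MvPolynomial.eval_map, MvPolynomial.aeval_def]
  have hpre : ∀ᶠ x in 𝓝 (fun i => p₀ i), f (WithLp.toLp 2 x) = 0 :=
    (PiLp.continuous_toLp 2 (fun _ : V × Fin d => ℝ)).tendsto (fun i => p₀ i) |>.eventually h
  obtain ⟨ε, hε, hball⟩ := Metric.nhds_basis_closedBall.eventually_iff.1 hpre
  have hzero : MvPolynomial.map (algebraMap K ℝ) q = 0 := by
    refine MvPolynomial.funext_set (fun i => Icc (p₀ i - ε) (p₀ i + ε))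
      (fun i => Icc_infinite (by linarith)) fun x hx => ?_
    rw [map_zero, ← haeval]
    have h1 : x ∈ Metric.closedBall (fun i => p₀ i) ε := by
      rw [closedBall_pi _ hε.le]
      intro i hi
      change x i ∈ Metric.closedBall (p₀ i) ε
      rw [Real.closedBall_eq_Icc]
      exact hx i hi
    rw [← hball h1, hq]
  rw [hq, haeval, hzero, map_zero]

theorem holdsGenerically_of_ne_zero {f : Config V d → ℝ} (hf : f ∈ polynomialFunctions V d K)
    {p₀ : Config V d} (h₀ : f p₀ ≠ 0) {P : Config V d → Prop} (h : ∀ p, f p ≠ 0 → P p) :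
    HoldsGenerically K P := by
  obtain ⟨q, hq⟩ := mem_polynomialFunctions_iff.1 hf
  refine ⟨q, fun h0 => h₀ (by rw [hq, h0, map_zero]), fun p hp => h p ?_⟩
  rwa [hq]

section Matrices

open Matrix Kronecker

variable {a b c : Type*}

variable (K) in
/-- All entries of a matrix depending on the configuration are polynomial functions. -/
def IsPolynomialMatrix (M : Config V d → Matrix a b ℝ) : Prop :=
  ∀ i j, (fun p => M p i j) ∈ polynomialFunctions V d K

theorem IsPolynomialMatrix.mul [Fintype b] {M : Config V d → Matrix a b ℝ}
    {N : Config V d → Matrix b c ℝ} (hM : IsPolynomialMatrix K M) (hN : IsPolynomialMatrix K N) :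
    IsPolynomialMatrix K fun p => M p * N p := by
  intro i j
  simp only [Matrix.mul_apply]
  have : (fun p => ∑ k, M p i k * N p k j) = ∑ k, (fun p => M p i k) * fun p => N p k j := by
    ext p; simp
  rw [this]
  exact sum_mem fun k _ => mul_mem (hM i k) (hN k j)

theorem IsPolynomialMatrix.transpose {M : Config V d → Matrix a b ℝ}
    (hM : IsPolynomialMatrix K M) : IsPolynomialMatrix K fun p => (M p)ᵀ := fun i j => hM j i

theorem IsPolynomialMatrix.submatrix {M : Config V d → Matrix a b ℝ}
    (hM : IsPolynomialMatrix K M) {a' b' : Type*} (f : a' → a) (g : b' → b) :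
    IsPolynomialMatrix K fun p => (M p).submatrix f g := fun i j => hM (f i) (g j)

theorem IsPolynomialMatrix.det [Fintype a] [DecidableEq a] {M : Config V d → Matrix a a ℝ}
    (hM : IsPolynomialMatrix K M) : (fun p => (M p).det) ∈ polynomialFunctions V d K := by
  have : (fun p => (M p).det) = ∑ σ : Equiv.Perm a,
      (Equiv.Perm.sign σ : ℤ) • ∏ i, fun p => M p (σ i) i := by
    ext p
    simp [Matrix.det_apply, Units.smul_def]
  rw [this]
  exact sum_mem fun σ _ => zsmul_mem (prod_mem fun i _ => hM (σ i) i) _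

theorem IsPolynomialMatrix.adjugate [Fintype a] [DecidableEq a] {M : Config V d → Matrix a a ℝ}
    (hM : IsPolynomialMatrix K M) : IsPolynomialMatrix K fun p => (M p).adjugate := by
  intro i j
  simp only [Matrix.adjugate_apply]
  refine IsPolynomialMatrix.det fun k l => ?_
  by_cases hk : k = j
  · subst hk
    by_cases hl : l = i
    · subst hl
      convert! one_mem (polynomialFunctions V d K) using 1
      ext p
      simp
    · convert! zero_mem (polynomialFunctions V d K) using 1
      ext p
      simp [Pi.single_eq_of_ne hl]
  · simpa [Matrix.updateRow_ne hk] using hM k l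

theorem IsPolynomialMatrix.kroneckerSum [Fintype a] [DecidableEq a]
    {M : Config V d → Matrix a a ℝ} (hM : IsPolynomialMatrix K M) :
    IsPolynomialMatrix K fun p => FormationControl.kroneckerSum (M p) := by
  have hone : ∀ i j, (fun _ : Config V d => (1 : Matrix a a ℝ) i j) ∈
      polynomialFunctions V d K := fun i j => by
    by_cases hij : i = j
    · subst hij
      convert! one_mem (polynomialFunctions V d K) using 1
      ext p
      simp
    · convert! zero_mem (polynomialFunctions V d K) using 1
      ext p
      simp [Matrix.one_apply_ne hij]
  intro i j
  exact add_mem (mul_mem (hM i.1 j.1) (hone i.2 j.2)) (mul_mem (hone i.1 j.1) (hM i.2 j.2))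

theorem isPolynomialMatrix_rigidityMatrix [DecidableEq V] (G : SimpleGraph V)
    [DecidableRel G.Adj] : IsPolynomialMatrix K (rigidityMatrix (d := d) G) := by
  rintro ⟨e, he⟩ k
  have hco := coordinate_mem_polynomialFunctions (V := V) (d := d) (K := K)
  induction e using Sym2.ind with
  | h i j =>
    simp only [rigidityMatrix, Sym2.lift_mk]
    refine (polynomialFunctions V d K).add_mem
      (x := fun p : Config V d => if k.1 = i then p (i, k.2) - p (j, k.2) else 0)
      (y := fun p : Config V d => if k.1 = j then p (j, k.2) - p (i, k.2) else 0) ?_ ?_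
    · split_ifs
      exacts [sub_mem (hco _) (hco _), zero_mem _]
    · split_ifs
      exacts [sub_mem (hco _) (hco _), zero_mem _]

theorem distanceMap_mem_polynomialFunctions (G : SimpleGraph V) [DecidableRel G.Adj]
    (e : G.edgeSet) : (fun p => distanceMap G p e) ∈ polynomialFunctions V d K := by
  obtain ⟨e, he⟩ := e
  have hco := coordinate_mem_polynomialFunctions (V := V) (d := d) (K := K)
  induction e using Sym2.ind with
  | h i j =>
    have : (fun p : Config V d => distanceMap G p ⟨s(i, j), he⟩) =
        ∑ a, ((fun p => p (j, a)) - fun p => p (i, a)) ^ 2 := by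
      ext p
      simp [distanceMap_apply]
    rw [this]
    exact sum_mem fun a _ => pow_mem (sub_mem (hco _) (hco _)) 2

/-- A matrix of rational functions, evaluated along a polynomial map, has a common denominator. -/
theorem exists_common_denominator [Fintype a] [Fintype b] {σ : Type*}
    {x : Config V d → σ → ℝ} (hx : ∀ i, (fun p => x p i) ∈ polynomialFunctions V d K)
    (M : Matrix a b (RationalExpr σ K)) {p₀ : Config V d}
    (hM : ∀ i j, (M i j).DefinedAt (x p₀)) :
    ∃ f ∈ polynomialFunctions V d K, f p₀ ≠ 0 ∧ ∃ N : Config V d → Matrix a b ℝ,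
      IsPolynomialMatrix K N ∧ ∀ p, f p ≠ 0 → (∀ i j, (M i j).DefinedAt (x p)) ∧
        N p = f p • M.map fun g => g.eval (x p) := by
  classical
  let den : a × b → Config V d → ℝ := fun k p => MvPolynomial.aeval (x p) (M k.1 k.2).den
  let num : a × b → Config V d → ℝ := fun k p => MvPolynomial.aeval (x p) (M k.1 k.2).num
  have hden : ∀ k, den k ∈ polynomialFunctions V d K := fun k =>
    aeval_mem_polynomialFunctions hx _
  refine ⟨∏ k, den k, prod_mem fun k _ => hden k, ?_,
    fun p => Matrix.of fun i j => num (i, j) p * ∏ k ∈ Finset.univ.erase (i, j), den k p, ?_, ?_⟩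
  · rw [Finset.prod_apply]
    exact Finset.prod_ne_zero_iff.2 fun k _ => hM k.1 k.2
  · intro i j
    have : (fun p => ∏ k ∈ Finset.univ.erase (i, j), den k p) ∈ polynomialFunctions V d K := by
      have h := prod_mem (S := polynomialFunctions V d K) (t := Finset.univ.erase (i, j))
        fun k _ => hden k
      convert! h using 1
      ext p
      rw [Finset.prod_apply]
    exact mul_mem (aeval_mem_polynomialFunctions hx _) this
  · intro p hp
    rw [Finset.prod_apply] at hp
    have hne : ∀ k, den k p ≠ 0 := fun k => Finset.prod_ne_zero_iff.1 hp k (Finset.mem_univ k)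
    refine ⟨fun i j => hne (i, j), ?_⟩
    ext i j
    have h1 := Finset.mul_prod_erase Finset.univ (fun k => den k p) (Finset.mem_univ (i, j))
    simp only [Matrix.of_apply, Matrix.smul_apply, Matrix.map_apply, smul_eq_mul,
      RationalExpr.eval, Finset.prod_apply]
    rw [← h1]
    change _ = den (i, j) p * _ * (num (i, j) p / den (i, j) p)
    field_simp [hne (i, j)]

end Matrices

end PolynomialFunctions

/-! ### Conclusion: from one stable target to generic configurations. -/

theorem IsHyperbolic.bijective {W : Type*} [AddCommGroup W] [Module ℝ W] [Module.Finite ℝ W]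
    {f : W →ₗ[ℝ] W} (hf : IsHyperbolic f) : Function.Bijective f := by
  have hinj : Function.Injective f := by
    rw [← LinearMap.ker_eq_bot, Submodule.eq_bot_iff]
    intro x hx
    by_contra hx0
    have hev : Module.End.HasEigenvalue f 0 :=
      Module.End.hasEigenvalue_of_hasEigenvector (x := x)
        ⟨Module.End.mem_eigenspace_iff.2 (by rw [zero_smul]; exact hx), hx0⟩
    have hroot := (Module.End.hasEigenvalue_iff_isRoot_charpoly f 0).1 hev
    refine hf (algebraMap ℝ ℂ 0) ?_ (by simp)
    rw [Polynomial.aeval_algebraMap_apply, Polynomial.coe_aeval_eq_eval, hroot.eq_zero, map_zero]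
  exact ⟨hinj, LinearMap.injective_iff_surjective.1 hinj⟩

variable {V : Type*} [Fintype V] [DecidableEq V] {K : Type*} [Field K] [Algebra K ℝ] {d : ℕ}
  {G : SimpleGraph V} [DecidableRel G.Adj]

theorem RationalMatrices.IsDynamicallyAdmissible.isAlgebraicallyAdmissible
    {c : RationalMatrices K d G} (h : c.IsDynamicallyAdmissible) :
    c.IsAlgebraicallyAdmissible := by
  obtain ⟨g, hg, H⟩ := h
  refine ⟨g, hg, fun p hp hS => ?_⟩
  obtain ⟨hdef, hT, hyp⟩ := H p hp hS
  exact ⟨hdef, hT, hyp.bijective⟩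

open Matrix in
/-- The tangency condition of a controller extends from its domain to all configurations where
suitable denominators do not vanish. -/
theorem RationalController.exists_denominator (c : RationalController K d G) {p₀ : Config V d}
    (h₀ : (p₀, distanceMap G p₀) ∈ c.domain) :
    ∃ f ∈ polynomialFunctions V d K, f p₀ ≠ 0 ∧
      ∃ H : Config V d → Matrix G.edgeSet G.edgeSet ℝ, IsPolynomialMatrix K H ∧ ∀ p, f p ≠ 0 →
        c.DefinedAt (p, distanceMap G p) ∧ (∃ s : ℝ, s ≠ 0 ∧
          H p = s • c.etaEntry.map fun g => g.eval (stateCoords (p, distanceMap G p))) ∧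
        ∀ x, c.eta (p, distanceMap G p) x ∈ edgeTangent G p := by
  have hcoords : ∀ i, (fun p : Config V d => stateCoords (p, distanceMap G p) i) ∈
      polynomialFunctions V d K := by
    rintro (i | e)
    exacts [coordinate_mem_polynomialFunctions i, distanceMap_mem_polynomialFunctions G e]
  obtain ⟨fη, hfη, hfη₀, H, hH, hHη⟩ :=
    exists_common_denominator hcoords c.etaEntry (c.defined _ h₀).2
  obtain ⟨fν, hfν, hfν₀, N, hN, hNν⟩ :=
    exists_common_denominator hcoords c.nuEntry (c.defined _ h₀).1
  -- Tangency with denominators cleared is a polynomial identity. It holds near `p₀`, where the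
  -- states `(p, F(p))` lie in the domain, hence everywhere.
  have htangent : ∀ p e e', fν p * H p e e' - 2 * fη p * (rigidityMatrix G p * N p) e e' = 0 := by
    intro p e e'
    have hpoly : (fun p => fν p * H p e e' - 2 * fη p * (rigidityMatrix G p * N p) e e') ∈
        polynomialFunctions V d K := by
      have hRN := (isPolynomialMatrix_rigidityMatrix G).mul hN e e'
      have h2 : (2 : Config V d → ℝ) ∈ polynomialFunctions V d K := by
        exact_mod_cast natCast_mem (polynomialFunctions V d K) 2
      exact sub_mem (mul_mem hfν (hH e e')) (mul_mem (mul_mem h2 hfη) hRN)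
    refine eq_zero_of_eventually_eq_zero hpoly (p₀ := p₀) ?_ p
    filter_upwards [c.eventually_mem_domain h₀,
      (continuous_of_mem_polynomialFunctions hfη).continuousAt.eventually_ne hfη₀,
      (continuous_of_mem_polynomialFunctions hfν).continuousAt.eventually_ne hfν₀] with q hq hqη hqν
    have h1 := congrArg (fun v : EdgeSpace G => v e)
      (c.tangent _ hq (EuclideanSpace.single e' (1 : ℝ)))
    have h2 : (c.etaEntry.map fun g => g.eval (stateCoords (q, distanceMap G q))) e e' =
        2 * (rigidityMatrix G q *
          c.nuEntry.map fun g => g.eval (stateCoords (q, distanceMap G q))) e e' := by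
      simpa [RationalMatrices.eta, RationalMatrices.nu, Matrix.toLpLin_apply, Matrix.mul_apply,
        Matrix.mulVec, dotProduct] using h1
    rw [(hHη q hqη).2, (hNν q hqν).2, Matrix.mul_smul]
    simp only [Matrix.smul_apply, smul_eq_mul, h2]
    ring
  refine ⟨fη * fν, mul_mem hfη hfν, mul_ne_zero hfη₀ hfν₀, H, hH, fun p hp => ?_⟩
  have hpη : fη p ≠ 0 := left_ne_zero_of_mul hp
  have hpν : fν p ≠ 0 := right_ne_zero_of_mul hp
  obtain ⟨hdη, hη⟩ := hHη p hpη
  obtain ⟨hdν, hν⟩ := hNν p hpν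
  refine ⟨⟨hdν, hdη⟩, ⟨fη p, hpη, hη⟩, fun x => ?_⟩
  have hmat : (c.etaEntry.map fun g => g.eval (stateCoords (p, distanceMap G p))) =
      rigidityMatrix G p * ((2 : ℝ) •
        c.nuEntry.map fun g => g.eval (stateCoords (p, distanceMap G p))) := by
    ext e e'
    have h1 := htangent p e e'
    rw [hη, hν, Matrix.mul_smul] at h1
    rw [Matrix.mul_smul]
    simp only [Matrix.smul_apply, smul_eq_mul] at h1 ⊢
    refine mul_left_cancel₀ (mul_ne_zero hpη hpν) ?_
    linear_combination h1
  refine ⟨WithLp.toLp 2 (((2 : ℝ) • c.nuEntry.map fun g =>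
    g.eval (stateCoords (p, distanceMap G p))) *ᵥ x), ?_⟩
  rw [RationalMatrices.eta, hmat, Matrix.toLpLin_apply, Matrix.toLpLin_apply, ← Matrix.mulVec_mulVec]

open Matrix in
theorem RationalController.isDynamicallyAdmissible (c : RationalController K d G)
    {p₀ : Config V d} (hstable : c.IsLocallyExpStable p₀) : c.IsDynamicallyAdmissible := by
  have h₀ : (p₀, distanceMap G p₀) ∈ c.domain := by
    obtain ⟨U, hUD, hmem, -⟩ := hstable
    exact hUD hmem
  have hreg : IsRegularPoint G p₀ := (c.mem_stateSpace h₀).1.2 p₀ rfl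
  obtain ⟨f, hf, hf₀, H, hH, hfH⟩ := c.exists_denominator h₀
  -- The columns are chosen at `p₀` and then kept fixed; they remain a basis of the tangent space
  -- wherever their Gram determinant is nonzero, because the rank is maximal at `p₀`.
  obtain ⟨J, hJ⟩ := exists_columns_det_gram_ne_zero (rigidityMatrix G p₀)
  have hQ : IsPolynomialMatrix K fun p : Config V d => (rigidityMatrix G p).submatrix id J :=
    (isPolynomialMatrix_rigidityMatrix G).submatrix id J
  have hGram := hQ.transpose.mul hQ
  have hres : IsPolynomialMatrix K fun p => restrictedMatrix (rigidityMatrix G p) J (H p) :=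
    ((hGram.adjugate.mul hQ.transpose).mul hH).mul hQ
  -- The generic condition is the nonvanishing of three factors: the denominators, the Gram
  -- determinant and the determinant of the Lyapunov operator.
  refine holdsGenerically_of_ne_zero (p₀ := p₀)
    (mul_mem hf (mul_mem hGram.det hres.kroneckerSum.det)) ?_ ?_
  · obtain ⟨-, ⟨s, hs, hHs⟩, hT⟩ := hfH p₀ hf₀
    refine mul_ne_zero hf₀ (mul_ne_zero hJ fun hdet => ?_)
    simp only [hHs] at hdet
    obtain ⟨α, β, hα, v, w, hvw, hv, hw⟩ :=
      exists_pair_of_det_kroneckerSum_restrictedMatrix_eq_zero le_rfl hs hJ (fun x => by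
        obtain ⟨w, hw⟩ := hT (WithLp.toLp 2 x)
        exact ⟨w, congrArg WithLp.ofLp hw.symm⟩) hdet
    refine hα.not_gt (hstable.re_pos (a := WithLp.toLp 2 (rigidityMatrix G p₀ *ᵥ v))
      (b := WithLp.toLp 2 (rigidityMatrix G p₀ *ᵥ w)) (β := β) ⟨WithLp.toLp 2 v, rfl⟩
      ⟨WithLp.toLp 2 w, rfl⟩ ?_ (congrArg (WithLp.toLp 2) hv) (congrArg (WithLp.toLp 2) hw))
    exact hvw.imp (fun h h1 => h (congrArg WithLp.ofLp h1)) (fun h h1 => h (congrArg WithLp.ofLp h1))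
  · intro p hp _
    have hfp := left_ne_zero_of_mul hp
    have hGp := left_ne_zero_of_mul (right_ne_zero_of_mul hp)
    have hdet := right_ne_zero_of_mul (right_ne_zero_of_mul hp)
    obtain ⟨hdef, ⟨s, -, hHs⟩, hT⟩ := hfH p hfp
    refine ⟨hdef, fun x _ => hT x, fun z hz hre => hdet ?_⟩
    obtain ⟨⟨a, v, hva⟩, ⟨b, w, hwb⟩, hab, ha, hb⟩ :=
      LinearMap.exists_real_pair_of_charpoly_root _ z hz
    rw [hre, zero_smul, zero_sub] at ha
    rw [hre, zero_smul, add_zero] at hb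
    have hva' : rigidityMatrix G p *ᵥ v = WithLp.ofLp a := congrArg WithLp.ofLp hva
    have hwb' : rigidityMatrix G p *ᵥ w = WithLp.ofLp b := congrArg WithLp.ofLp hwb
    simp only [hHs]
    refine det_kroneckerSum_restrictedMatrix_eq_zero (β := z.im) (hreg p) hGp v w ?_ ?_ ?_
    · rw [hva', hwb']
      exact hab.imp (fun h h1 => h (Subtype.ext (WithLp.ofLp_injective 2 h1)))
        (fun h h1 => h (Subtype.ext (WithLp.ofLp_injective 2 h1)))
    · rw [hva', hwb']
      exact congrArg (fun u : edgeTangent G p => WithLp.ofLp (u : EdgeSpace G)) ha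
    · rw [hva', hwb']
      exact congrArg (fun u : edgeTangent G p => WithLp.ofLp (u : EdgeSpace G)) hb

end FormationControl

theorem theorem4 {V : Type*} [Fintype V] [DecidableEq V] (d : ℕ)
    (G : SimpleGraph V) [DecidableRel G.Adj]
    (hG : FormationControl.IsGenericallyRigid d G)
    (K : Type*) [Field K] [Algebra K ℝ]
    (c : FormationControl.RationalController K d G)
    (pStar : FormationControl.Config V d)
    (hstable : c.IsLocallyExpStable pStar) :
    c.IsDynamicallyAdmissible ∧ c.IsAlgebraicallyAdmissible :=
  have h := c.isDynamicallyAdmissible hstable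
  ⟨h, h.isAlgebraicallyAdmissible⟩
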